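/- \textbf{Reformulation of the upper bound for the expected negative log-likelihood (ENLL).} \emph{Notation.} Let $\mathbb N=\{1,2,\dots\}$ and let $\mathbb I$ be the $d\times d$ identity matrix. For $x,v\in\mathbb R^d$ and a symmetric positive definite $Q\in\mathbb R^{d\times d}$ let $n(x,v,Q)=(2\pi)^{-d/2}\det(Q)^{-1/2}\exp(-\tfrac12(x-v)^{*}Q^{-1}(x-v))$. For probability densities $p,q\colon\mathbb R^d\to(0,\infty)$ let $H(p,q)=\int_{\mathbb R^d}-\ln(q(x))\,p(x)\,\mathrm dx$ (the ENLL, or cross-entropy, of $q$ with respect to $p$) and $D(p\|q)=\int_{\mathbb R^d}\ln\big(\tfrac{p(x)}{q(x)}\big)p(x)\,\mathrm dx$ (the Kullback--Leibler divergence). Integrals and expectations are extended-real valued (integral of the positive part minus integral of the negative part). \emph{Setting.} Let $d,\mathfrak d,T\in\mathbb N$ and let $(\Omega,\mathcal F,\mathbb P)$ be a probability space. For every $\theta\in\mathbb R^{\mathfrak d}\cup\{\emptyset\}$ let $X^\theta=(X^\theta_t)_{t\in\{0,\dots,T\}}$ be an $\mathbb R^d$-valued stochastic process on $\Omega$ whose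 law has a measurable, everywhere positive joint Lebesgue density $p^\theta\colon(\mathbb R^d)^{T+1}\to(0,\infty)$, and assume that $(X^\theta)_{\theta\in\mathbb R^{\mathfrak d}}$ and $X^\emptyset$ are independent. For nonempty $A\subseteq\{0,\dots,T\}$ let $p^\theta_A$ be the marginal density obtained from $p^\theta$ by integrating out the variables $x_t$, $t\notin A$, and assume that it is finite everywhere. For disjoint nonempty $A,B\subseteq\{0,\dots,T\}$ let $p^\theta_{A|B}=p^\theta_{A\cup B}/p^\theta_B$ be the conditional density. Let $\Pi=n(\cdot,0,\mathbb I)$, let $\alpha_1,\dots,\alpha_T\in[0,1)$, and for all $\theta\in\mathbb R^{\mathfrak d}$, $t\in\{1,\dots,T\}$ let $\mu^\theta_t\colon\mathbb R^d\to\mathbb R^d$ and $\Sigma^\theta_t$, a function from $\mathbb R^d$ to the symmetric positive definite $d\times d$ matrices, be measurable. Assume for all $\theta\in\mathbb R^{\mathfrak d}$, $t\in\{1,\dots,T\}$, $x_0,\dots,x_T\in\mathbb R^d$ that $p^\theta_T=\Pi$, \[p^\emptyset_{t|t-1,\dots,0}(x_t|x_{t-1},\dots,x_0)=p^\emptyset_{t|t-1}(x_t|x_{t-1})=n(x_t,\sqrt{\alpha_t}\,x_{t-1},(1-\alpha_t)\mathbb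 I),\] \[p^\theta_{t-1|t,\dots,T}(x_{t-1}|x_t,\dots,x_T)=p^\theta_{t-1|t}(x_{t-1}|x_t)=n(x_{t-1},\mu^\theta_t(x_t),\Sigma^\theta_t(x_t)).\] Let $\bar\alpha_0,\dots,\bar\alpha_T,\tilde\beta_1,\dots,\tilde\beta_T\in(0,1)$ satisfy for all $t\in\{1,\dots,T\}$ that $\bar\alpha_t=\prod_{s=1}^t\alpha_s$ and $\tilde\beta_t=\frac{1-\bar\alpha_{t-1}}{1-\bar\alpha_t}(1-\alpha_t)$ (the number $\bar\alpha_0\in(0,1)$ is otherwise arbitrary). For every $t\in\{0,\dots,T\}$ let $\mathcal E_t\colon\Omega\to\mathbb R^d$ satisfy $X^\emptyset_t=\sqrt{\bar\alpha_t}X^\emptyset_0+\sqrt{1-\bar\alpha_t}\,\mathcal E_t$. For every $\theta\in\mathbb R^{\mathfrak d}$ let $V^\theta\colon\mathbb R^d\times\mathbb R\to\mathbb R^d$ be measurable, and assume for all $\theta\in\mathbb R^{\mathfrak d}$, $t\in\{1,\dots,T\}$, $x\in\mathbb R^d$ that \[\mu^\theta_t(x)=\tfrac1{\sqrt{\alpha_t}}\Big(x-\tfrac{1-\alpha_t}{\sqrt{1-\bar\alpha_t}}V^\theta(x,t)\Big)\quad\text{and}\quad\Sigma^\theta_t(x)=\tilde\beta_t\mathbb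 I .\] \emph{Conclusion.} (i) For all $\theta\in\mathbb R^{\mathfrak d}$ the ENLL $H(p^\emptyset_0,p^\theta_0)$ is well defined in $\mathbb R\cup\{\infty\}$ and \[H(p^\emptyset_0,p^\theta_0)=\mathbb E\big[-\ln p^\theta_0(X^\emptyset_0)\big]\le\mathbb E\big[D\big(p^\emptyset_{T|0}(\cdot|X^\emptyset_0)\,\big\|\,\Pi\big)\big]+\tfrac d2\ln(2\pi\tilde\beta_1)+\sum_{t=1}^T\frac{1}{2\tilde\beta_t}\frac{(1-\alpha_t)^2}{(1-\bar\alpha_t)\alpha_t}\,\mathbb E\Big[\big\|\mathcal E_t-V^\theta\big(\sqrt{\bar\alpha_t}X^\emptyset_0+\sqrt{1-\bar\alpha_t}\,\mathcal E_t,t\big)\big\|_2^2\Big].\] (ii) For all $t\in\{1,\dots,T\}$ the random variables $\mathcal E_t$ and $X^\emptyset_0$ are independent, and $\mathbb P(\mathcal E_t\in B)=\int_Bn(x,0,\mathbb I)\,\mathrm dx$ for all Borel sets $B\subseteq\mathbb R^d$. (iii) For all $\theta\in\mathbb R^{\mathfrak d}$ there exist i.i.d. random variables $Z^\theta_t\colon\Omega\to\mathbb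 R^d$, $t\in\{1,\dots,T+1\}$, such that $\mathbb P(Z^\theta_1\in B)=\int_Bn(z,0,\mathbb I)\,\mathrm dz$ for all Borel sets $B\subseteq\mathbb R^d$, $X^\theta_T=Z^\theta_{T+1}$, and for all $t\in\{1,\dots,T\}$ \[X^\theta_{t-1}=\frac1{\sqrt{\alpha_t}}\Big(X^\theta_t-\frac{1-\alpha_t}{\sqrt{1-\bar\alpha_t}}V^\theta(X^\theta_t,t)\Big)+\sqrt{\tilde\beta_t}\,Z^\theta_t .\] -/

import Mathlib

open MeasureTheory ProbabilityTheory

noncomputable section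

namespace DDPM

/-- The integral of an extended-real valued function with respect to `μ`: the integral of the
positive part minus the integral of the negative part. By the convention `⊤ - ⊤ = ⊥` of `EReal`
it is different from `⊥` exactly if the negative part has finite integral. -/
def extIntegral {α : Type*} [MeasurableSpace α] (μ : Measure α) (f : α → EReal) : EReal :=
  ((∫⁻ x, (f x).toENNReal ∂μ : ENNReal) : EReal) - ((∫⁻ x, (-f x).toENNReal ∂μ : ENNReal) : EReal)

/-- The density at `x` of the Gaussian distribution on `ℝ^d` with mean `v` and covariance matrix
`Q` (used for symmetric positive definite `Q`). -/
def gaussianDensity {d : ℕ} (x v : EuclideanSpace ℝ (Fin d)) (Q : Matrix (Fin d) (Fin d) ℝ) : ℝ :=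
  (2 * Real.pi) ^ (-(d : ℝ) / 2) * Q.det ^ (-(1 : ℝ) / 2) *
    Real.exp (-(1 / 2) * ((x - v).ofLp ⬝ᵥ (Q⁻¹.mulVec (x - v).ofLp)))

/-- The expected negative log-likelihood (cross-entropy) of `q` with respect to `p`. -/
def expNegLogLik {d : ℕ} (p q : EuclideanSpace ℝ (Fin d) → ℝ) : EReal :=
  extIntegral volume (fun x => ((-Real.log (q x) * p x : ℝ) : EReal))

/-- The Kullback-Leibler divergence of the probability density `p` from the probability
density `q`. -/
def klDensity {d : ℕ} (p q : EuclideanSpace ℝ (Fin d) → ℝ) : EReal :=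
  extIntegral volume (fun x => ((Real.log (p x / q x) * p x : ℝ) : EReal))

/-- The joint density `p` of `(x_0, …, x_T)`, integrated over all the coordinates `x_t` with
`t ∉ A`, as a `[0, ∞]`-valued function of the remaining coordinates (it is written as a function
of the whole vector `x`, but only depends on `x_t`, `t ∈ A`). -/
def lmargDensity {d T : ℕ} (p : (Fin (T + 1) → EuclideanSpace ℝ (Fin d)) → ℝ)
    (A : Finset (Fin (T + 1))) (x : Fin (T + 1) → EuclideanSpace ℝ (Fin d)) : ENNReal :=
  lmarginal (fun _ => volume) Aᶜ (fun y => ENNReal.ofReal (p y)) x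

/-- The marginal density of the times in `A`; it only depends on `x_t`, `t ∈ A`. -/
def margDensity {d T : ℕ} (p : (Fin (T + 1) → EuclideanSpace ℝ (Fin d)) → ℝ)
    (A : Finset (Fin (T + 1))) (x : Fin (T + 1) → EuclideanSpace ℝ (Fin d)) : ℝ :=
  (lmargDensity p A x).toReal

/-- The conditional density of the times in `A` given the times in `B`;
it only depends on `x_t`, `t ∈ A ∪ B`. -/
def condDensity {d T : ℕ} (p : (Fin (T + 1) → EuclideanSpace ℝ (Fin d)) → ℝ)
    (A B : Finset (Fin (T + 1))) (x : Fin (T + 1) → EuclideanSpace ℝ (Fin d)) : ℝ :=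
  margDensity p (A ∪ B) x / margDensity p B x

/-- The general framework. The index `none` stands for the forward process and the index `some θ`
for the backward process with parameter `θ ∈ ℝ^D`. -/
structure Framework {d D T : ℕ} {Ω : Type*} [MeasurableSpace Ω] (P : Measure Ω)
    (X : Option (EuclideanSpace ℝ (Fin D)) → Fin (T + 1) → Ω → EuclideanSpace ℝ (Fin d))
    (p : Option (EuclideanSpace ℝ (Fin D)) → (Fin (T + 1) → EuclideanSpace ℝ (Fin d)) → ℝ)
    (prior : EuclideanSpace ℝ (Fin d) → ℝ) : Prop where
  measurable_process : ∀ θ t, Measurable (X θ t)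
  indep : IndepFun (fun ω (θ : EuclideanSpace ℝ (Fin D)) t => X (some θ) t ω)
    (fun ω t => X none t ω) P
  measurable_density : ∀ θ, Measurable (p θ)
  density_pos : ∀ θ x, 0 < p θ x
  /-- `p θ` is the joint density of `(X^θ_0, …, X^θ_T)`. -/
  law : ∀ θ (B : Fin (T + 1) → Set (EuclideanSpace ℝ (Fin d))), (∀ t, MeasurableSet (B t)) →
    P {ω | ∀ t, X θ t ω ∈ B t} = ∫⁻ x in Set.univ.pi B, ENNReal.ofReal (p θ x)
  /-- The marginal densities take finite values. -/
  marginal_finite : ∀ θ (A : Finset (Fin (T + 1))), A.Nonempty → ∀ x, lmargDensity (p θ) A x ≠ ⊤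
  prior_pos : ∀ x, 0 < prior x
  terminal : ∀ θ x, margDensity (p (some θ)) {Fin.last T} x = prior (x (Fin.last T))

/-- The framework with Markov assumptions. For `t : Fin T` the times `t.castSucc` and `t.succ`
are the beginning and the end of a time step. -/
structure MarkovFramework {d D T : ℕ} {Ω : Type*} [MeasurableSpace Ω] (P : Measure Ω)
    (X : Option (EuclideanSpace ℝ (Fin D)) → Fin (T + 1) → Ω → EuclideanSpace ℝ (Fin d))
    (p : Option (EuclideanSpace ℝ (Fin D)) → (Fin (T + 1) → EuclideanSpace ℝ (Fin d)) → ℝ)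
    (prior : EuclideanSpace ℝ (Fin d) → ℝ) : Prop extends Framework P X p prior where
  markov_forward : ∀ (t : Fin T) x,
    condDensity (p none) {t.succ} (Finset.Iic t.castSucc) x =
      condDensity (p none) {t.succ} {t.castSucc} x
  markov_backward : ∀ θ (t : Fin T) x,
    condDensity (p (some θ)) {t.castSucc} (Finset.Ici t.succ) x =
      condDensity (p (some θ)) {t.castSucc} {t.succ} x

/-- The framework with Gaussian transition kernels. Only the values of `α`, `mean θ`, `cov θ` at
the times `t.succ`, `t : Fin T`, (that is, at the times `1, …, T`) are used. -/
structure GaussianFramework {d D T : ℕ} {Ω : Type*} [MeasurableSpace Ω] (P : Measure Ω)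
    (X : Option (EuclideanSpace ℝ (Fin D)) → Fin (T + 1) → Ω → EuclideanSpace ℝ (Fin d))
    (p : Option (EuclideanSpace ℝ (Fin D)) → (Fin (T + 1) → EuclideanSpace ℝ (Fin d)) → ℝ)
    (prior : EuclideanSpace ℝ (Fin d) → ℝ) (α : Fin (T + 1) → ℝ)
    (mean : EuclideanSpace ℝ (Fin D) → Fin (T + 1) →
      EuclideanSpace ℝ (Fin d) → EuclideanSpace ℝ (Fin d))
    (cov : EuclideanSpace ℝ (Fin D) → Fin (T + 1) →
      EuclideanSpace ℝ (Fin d) → Matrix (Fin d) (Fin d) ℝ) : Prop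
    extends MarkovFramework P X p prior where
  alpha_mem : ∀ t : Fin T, α t.succ ∈ Set.Ico (0 : ℝ) 1
  measurable_mean : ∀ θ (t : Fin T), Measurable (mean θ t.succ)
  measurable_cov : ∀ θ (t : Fin T) i j, Measurable (fun x => cov θ t.succ x i j)
  cov_posDef : ∀ θ (t : Fin T) x, (cov θ t.succ x).PosDef
  forward_kernel : ∀ (t : Fin T) x,
    condDensity (p none) {t.succ} {t.castSucc} x =
      gaussianDensity (x t.succ) (Real.sqrt (α t.succ) • x t.castSucc) ((1 - α t.succ) • 1)
  prior_eq : ∀ x, prior x = gaussianDensity x 0 1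
  backward_kernel : ∀ θ (t : Fin T) x,
    condDensity (p (some θ)) {t.castSucc} {t.succ} x =
      gaussianDensity (x t.castSucc) (mean θ t.succ (x t.succ)) (cov θ t.succ (x t.succ))

end DDPM

end

/-!
The proof works with the random vectors rather than with the densities of the posterior
distributions.

A Gaussian conditional density says that the standardized increment `ε = (Y i - m (Y j)) / √s` is
standard Gaussian and independent of the vectors that are conditioned upon
(`HasJointDensity.hasLaw_standardized`, `HasJointDensity.indepFun_standardized`). Applied backwards
in time, this gives the i.i.d. noise vectors driving that process, since random vectors are
independent as soon as each of them is independent of the later ones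
(`HasJointDensity.exists_iid_backward`). Applied forwards in time, it shows that the cumulative
noise satisfies `E' = a • E + b • ε` with `a ^ 2 + b ^ 2 = 1` and with `ε` independent of the past.
The law of two independent standard Gaussian vectors is invariant under rotations, so `E'` and
`N = -b • E + a • ε` are again standard Gaussian and independent of each other and of the initial
value (`HasJointDensity.hasLaw_noise`, `HasJointDensity.exists_posterior_noise`). The vector `N` is
the noise of the posterior distribution of the previous step given the current and the initial
value, and the residual of the backward mean is a combination of `N` and of the prediction error
`E' - V`.

For the upper bound, let `q` and `q'` be the joint densities of the forward and the backward
process. The likelihood ratio `L = q' q₀ / (q q'₀)`, evaluated at the forward process, has mean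
one. Hence `log L ≤ L - 1` gives the variational bound
`𝔼[-log q'₀(X₀)] ≤ 𝔼[log q - log q₀ - log q']` (`HasJointDensity.extIntegral_neg_log_le`). By the
chain rule the right-hand side is a sum of quadratic expressions, which the rotation identity
`‖E‖ ^ 2 + ‖ε‖ ^ 2 = ‖E'‖ ^ 2 + ‖N‖ ^ 2` turns into a telescoping sum, the squared prediction
errors, and inner products of `N` with the prediction errors (`HasJointDensity.log_ratio_eq`). The
inner products have mean zero by independence, and the boundary terms of the telescoping sum are
the expected divergence of the terminal conditional density from the prior and the logarithmic
constant (`HasJointDensity.extIntegral_neg_log_le_noise`). If one of the expectations on the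
right-hand side is infinite, the bound is trivial, because all the others are bounded from below.
-/

namespace DDPM

/-! ### Gaussian densities and the standard Gaussian measure -/

section

variable {d T : ℕ}

lemma gaussianDensity_smul_one (x v : EuclideanSpace ℝ (Fin d)) {s : ℝ} (hs : 0 < s) :
    gaussianDensity x v (s • 1) =
      (2 * Real.pi * s) ^ (-(d : ℝ) / 2) * Real.exp (-(‖x - v‖ ^ 2 / (2 * s))) := by
  have h1 : ((s • (1 : Matrix (Fin d) (Fin d) ℝ)).det) ^ (-(1 : ℝ) / 2) = s ^ (-(d : ℝ) / 2) := by
    rw [Matrix.det_smul, Matrix.det_one, mul_one, Fintype.card_fin, ← Real.rpow_natCast,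
      ← Real.rpow_mul hs.le]
    congr 1; ring
  have h2 : (s • (1 : Matrix (Fin d) (Fin d) ℝ))⁻¹ = s⁻¹ • 1 := by
    apply Matrix.inv_eq_left_inv
    rw [smul_mul_smul_comm, one_mul, inv_mul_cancel₀ hs.ne', one_smul]
  have h3 : (x - v).ofLp ⬝ᵥ (x - v).ofLp = ‖x - v‖ ^ 2 := by
    rw [EuclideanSpace.real_norm_sq_eq, dotProduct]
    exact Finset.sum_congr rfl fun i _ => by ring
  rw [gaussianDensity, h1, h2, Matrix.smul_mulVec, Matrix.one_mulVec, dotProduct_smul, h3,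
    Real.mul_rpow (by positivity) hs.le]
  congr 2
  rw [smul_eq_mul]
  field_simp

lemma gaussianDensity_zero_one (x : EuclideanSpace ℝ (Fin d)) :
    gaussianDensity x 0 1 = (2 * Real.pi) ^ (-(d : ℝ) / 2) * Real.exp (-(‖x‖ ^ 2 / 2)) := by
  have := gaussianDensity_smul_one x 0 one_pos
  simpa using this

lemma gaussianDensity_pos (x v : EuclideanSpace ℝ (Fin d)) {s : ℝ} (hs : 0 < s) :
    0 < gaussianDensity x v (s • 1) := by
  rw [gaussianDensity_smul_one x v hs]; positivity

lemma gaussianDensity_le (x v : EuclideanSpace ℝ (Fin d)) {s : ℝ} (hs : 0 < s) :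
    gaussianDensity x v (s • 1) ≤ (2 * Real.pi * s) ^ (-(d : ℝ) / 2) := by
  rw [gaussianDensity_smul_one x v hs]
  exact mul_le_of_le_one_right (by positivity) (Real.exp_le_one_iff.2 (by
    rw [neg_nonpos]; positivity))

lemma log_gaussianDensity (x v : EuclideanSpace ℝ (Fin d)) {s : ℝ} (hs : 0 < s) :
    Real.log (gaussianDensity x v (s • 1)) =
      -(d : ℝ) / 2 * Real.log (2 * Real.pi * s) - ‖x - v‖ ^ 2 / (2 * s) := by
  rw [gaussianDensity_smul_one x v hs, Real.log_mul (by positivity) (by positivity),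
    Real.log_rpow (by positivity), Real.log_exp]
  ring

lemma measurable_gaussianDensity {α : Type*} [MeasurableSpace α]
    {f g : α → EuclideanSpace ℝ (Fin d)} (hf : Measurable f) (hg : Measurable g)
    {s : ℝ} (hs : 0 < s) : Measurable fun a => gaussianDensity (f a) (g a) (s • 1) := by
  simp_rw [gaussianDensity_smul_one _ _ hs]
  fun_prop

/-- The standard Gaussian measure has the density `gaussianDensity · 0 1`; both measures have the
same characteristic function. -/
lemma stdGaussian_eq_withDensity :
    stdGaussian (EuclideanSpace ℝ (Fin d)) =
      volume.withDensity fun x => ENNReal.ofReal (gaussianDensity x 0 1) := by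
  have hint : Integrable (fun x : EuclideanSpace ℝ (Fin d) => gaussianDensity x 0 1) := by
    simp_rw [gaussianDensity_zero_one]
    have := (GaussianFourier.integrable_cexp_neg_mul_sq_norm_add
      (V := EuclideanSpace ℝ (Fin d)) (b := (1 / 2 : ℂ)) (by norm_num) 0 0).norm
    refine (this.congr (ae_of_all _ fun x => ?_)).const_mul _
    simp only [inner_zero_left, Complex.norm_exp]
    congr 1
    rw [zero_mul, add_zero, show -(1 / 2 : ℂ) * (‖x‖ : ℂ) ^ 2 = ((-(‖x‖ ^ 2 / 2) : ℝ) : ℂ) by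
      push_cast; ring, Complex.ofReal_re]
  have hnn : ∀ x : EuclideanSpace ℝ (Fin d), 0 ≤ gaussianDensity x 0 1 := fun x => by
    rw [gaussianDensity_zero_one]; positivity
  have hfin : IsFiniteMeasure (volume.withDensity
      fun x : EuclideanSpace ℝ (Fin d) => ENNReal.ofReal (gaussianDensity x 0 1)) :=
    isFiniteMeasure_withDensity_ofReal hint.2
  apply Measure.ext_of_charFun
  ext t
  have hm : Measurable fun x : EuclideanSpace ℝ (Fin d) => gaussianDensity x 0 1 := by
    simp_rw [gaussianDensity_zero_one]; fun_prop
  rw [charFun_stdGaussian, charFun_apply, integral_withDensity_eq_integral_toReal_smul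
    (by fun_prop) (ae_of_all _ fun x => ENNReal.ofReal_lt_top)]
  have h1 := GaussianFourier.integral_cexp_neg_mul_sq_norm_add
    (V := EuclideanSpace ℝ (Fin d)) (b := (1 / 2 : ℂ)) (by norm_num) Complex.I t
  have h2 : ∀ x : EuclideanSpace ℝ (Fin d),
      (ENNReal.ofReal (gaussianDensity x 0 1)).toReal • Complex.exp (inner ℝ x t * Complex.I) =
      (((2 * Real.pi) ^ (-(d : ℝ) / 2) : ℝ) : ℂ) *
        Complex.exp (-(1 / 2 : ℂ) * (‖x‖ : ℂ) ^ 2 + Complex.I * inner ℝ t x) := fun x => by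
    rw [ENNReal.toReal_ofReal (hnn x), gaussianDensity_zero_one, Complex.real_smul,
      Complex.ofReal_mul, mul_assoc, Complex.ofReal_exp, ← Complex.exp_add, real_inner_comm]
    congr 2
    push_cast
    ring
  simp_rw [h2]
  rw [integral_const_mul, h1, ← mul_assoc]
  have h3 : (((2 * Real.pi) ^ (-(d : ℝ) / 2) : ℝ) : ℂ) *
      ((Real.pi : ℂ) / (1 / 2)) ^ ((Module.finrank ℝ (EuclideanSpace ℝ (Fin d)) : ℂ) / 2) = 1 := by
    rw [finrank_euclideanSpace_fin, show ((Real.pi : ℂ) / (1 / 2)) = ((2 * Real.pi : ℝ) : ℂ) by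
      push_cast; ring, show ((d : ℂ) / 2) = (((d : ℝ) / 2 : ℝ) : ℂ) by push_cast; rfl,
      ← Complex.ofReal_cpow (by positivity), ← Complex.ofReal_mul,
      ← Real.rpow_add (by positivity)]
    norm_num [neg_div]
  rw [h3, one_mul, Complex.I_sq]
  congr 1
  ring

/-- Standardizing a Gaussian with mean `v` and covariance `s • 1` gives the standard Gaussian. -/
lemma lintegral_standardize_mul_gaussianDensity {F : EuclideanSpace ℝ (Fin d) → ENNReal}
    (hF : Measurable F) (v : EuclideanSpace ℝ (Fin d)) {s : ℝ} (hs : 0 < s) :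
    ∫⁻ y, F ((1 / √s) • (y - v)) * ENNReal.ofReal (gaussianDensity y v (s • 1)) =
      ∫⁻ z, F z ∂stdGaussian (EuclideanSpace ℝ (Fin d)) := by
  have hs' : 0 < √s := Real.sqrt_pos.2 hs
  have hm : Measurable fun x : EuclideanSpace ℝ (Fin d) => gaussianDensity x 0 1 := by
    simp_rw [gaussianDensity_zero_one]; fun_prop
  rw [stdGaussian_eq_withDensity, lintegral_withDensity_eq_lintegral_mul _ (by fun_prop) hF]
  have h1 : ∀ y, F ((1 / √s) • (y - v)) * ENNReal.ofReal (gaussianDensity y v (s • 1)) =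
      ENNReal.ofReal (s ^ (-(d : ℝ) / 2)) *
        (fun z => ENNReal.ofReal (gaussianDensity z 0 1) * F z) ((1 / √s) • (y - v)) := fun y => by
    have : gaussianDensity y v (s • 1) =
        s ^ (-(d : ℝ) / 2) * gaussianDensity ((1 / √s) • (y - v)) 0 1 := by
      rw [gaussianDensity_smul_one y v hs, gaussianDensity_zero_one,
        Real.mul_rpow (by positivity) hs.le, norm_smul, mul_pow, Real.norm_eq_abs, sq_abs, div_pow,
        Real.sq_sqrt hs.le]
      field_simp
    rw [this, ENNReal.ofReal_mul (by positivity)]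
    ring
  simp_rw [h1]
  have hG : Measurable fun z => ENNReal.ofReal (gaussianDensity z 0 1) * F z := by fun_prop
  rw [lintegral_const_mul _ (by fun_prop),
    lintegral_sub_right_eq_self (μ := (volume : Measure (EuclideanSpace ℝ (Fin d))))
      (fun y => (fun z => ENNReal.ofReal (gaussianDensity z 0 1) * F z) ((1 / √s) • y)) v,
    ← lintegral_map (f := fun z => ENNReal.ofReal (gaussianDensity z 0 1) * F z)
      (g := fun y => (1 / √s) • y) hG (by fun_prop),
    Measure.map_addHaar_smul _ (by positivity : (1 / √s) ≠ 0), lintegral_smul_measure,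
    smul_eq_mul, ← mul_assoc, ← ENNReal.ofReal_mul (by positivity)]
  have h4 : s ^ (-(d : ℝ) / 2) *
      |((1 / √s) ^ Module.finrank ℝ (EuclideanSpace ℝ (Fin d)))⁻¹| = 1 := by
    rw [finrank_euclideanSpace_fin, abs_of_pos (by positivity), one_div, inv_pow, inv_inv,
      Real.sqrt_eq_rpow, ← Real.rpow_natCast, ← Real.rpow_mul hs.le, ← Real.rpow_add hs]
    convert Real.rpow_zero s using 2
    ring
  rw [h4, ENNReal.ofReal_one, one_mul]
  rfl

end

/-! ### Marginal densities and standardized increments -/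

section

variable {d T : ℕ}

lemma measurable_lmargDensity {q : (Fin (T + 1) → EuclideanSpace ℝ (Fin d)) → ℝ}
    (hq : Measurable q) (A : Finset (Fin (T + 1))) : Measurable (lmargDensity q A) :=
  Measurable.lmarginal _ hq.ennreal_ofReal

lemma measurable_margDensity {q : (Fin (T + 1) → EuclideanSpace ℝ (Fin d)) → ℝ}
    (hq : Measurable q) (A : Finset (Fin (T + 1))) : Measurable (margDensity q A) :=
  (measurable_lmargDensity hq A).ennreal_toReal

lemma lmargDensity_congr (q : (Fin (T + 1) → EuclideanSpace ℝ (Fin d)) → ℝ)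
    (A : Finset (Fin (T + 1))) {x y : Fin (T + 1) → EuclideanSpace ℝ (Fin d)}
    (h : ∀ i ∈ A, x i = y i) : lmargDensity q A x = lmargDensity q A y :=
  lmarginal_congr _ _ fun i hi => h i (by simpa using hi)

lemma margDensity_congr (q : (Fin (T + 1) → EuclideanSpace ℝ (Fin d)) → ℝ)
    (A : Finset (Fin (T + 1))) {x y : Fin (T + 1) → EuclideanSpace ℝ (Fin d)}
    (h : ∀ i ∈ A, x i = y i) : margDensity q A x = margDensity q A y := by
  rw [margDensity, margDensity, lmargDensity_congr q A h]

lemma lmargDensity_pos {q : (Fin (T + 1) → EuclideanSpace ℝ (Fin d)) → ℝ}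
    (hq : Measurable q) (hpos : ∀ x, 0 < q x) (A : Finset (Fin (T + 1)))
    (x : Fin (T + 1) → EuclideanSpace ℝ (Fin d)) : 0 < lmargDensity q A x := by
  have hm : Measurable fun y : (i : ((Aᶜ : Finset (Fin (T + 1))))) → EuclideanSpace ℝ (Fin d) =>
      ENNReal.ofReal (q (Function.updateFinset x Aᶜ y)) :=
    hq.ennreal_ofReal.comp measurable_updateFinset
  rw [lmargDensity, lmarginal, lintegral_pos_iff_support hm]
  have : Function.support (fun y : (i : ((Aᶜ : Finset (Fin (T + 1))))) →
      EuclideanSpace ℝ (Fin d) =>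
      ENNReal.ofReal (q (Function.updateFinset x Aᶜ y))) = Set.univ := by
    ext y
    simp [hpos]
  rw [this]
  exact NeZero.pos _

lemma margDensity_pos {q : (Fin (T + 1) → EuclideanSpace ℝ (Fin d)) → ℝ}
    (hq : Measurable q) (hpos : ∀ x, 0 < q x) {A : Finset (Fin (T + 1))}
    {x : Fin (T + 1) → EuclideanSpace ℝ (Fin d)} (hfin : lmargDensity q A x ≠ ⊤) :
    0 < margDensity q A x :=
  ENNReal.toReal_pos (lmargDensity_pos hq hpos A x).ne' hfin

lemma margDensity_univ {q : (Fin (T + 1) → EuclideanSpace ℝ (Fin d)) → ℝ}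
    (hpos : ∀ x, 0 < q x) (x : Fin (T + 1) → EuclideanSpace ℝ (Fin d)) :
    margDensity q Finset.univ x = q x := by
  rw [margDensity, lmargDensity, Finset.compl_univ, lmarginal_empty,
    ENNReal.toReal_ofReal (hpos x).le]

/-- Integrating a function of the coordinates in `A` against the joint density amounts to
integrating it against the marginal density. -/
lemma lintegral_mul_ofReal_of_dependsOn {q : (Fin (T + 1) → EuclideanSpace ℝ (Fin d)) → ℝ}
    (hq : Measurable q) {A : Finset (Fin (T + 1))}
    {F : (Fin (T + 1) → EuclideanSpace ℝ (Fin d)) → ENNReal} (hF : Measurable F)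
    (hdep : DependsOn F (A : Set (Fin (T + 1))))
    (x₀ : Fin (T + 1) → EuclideanSpace ℝ (Fin d)) :
    ∫⁻ x, F x * ENNReal.ofReal (q x) =
      lmarginal (fun _ => volume) A (fun x => F x * lmargDensity q A x) x₀ := by
  have hFq : Measurable fun x => F x * ENNReal.ofReal (q x) := by fun_prop
  rw [volume_pi, lintegral_eq_lmarginal_univ x₀, ← Finset.union_compl A,
    lmarginal_union _ _ hFq disjoint_compl_right]
  congr 1
  funext x
  have hm : Measurable fun y : (i : ((Aᶜ : Finset (Fin (T + 1))))) → EuclideanSpace ℝ (Fin d) =>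
      ENNReal.ofReal (q (Function.updateFinset x Aᶜ y)) :=
    hq.ennreal_ofReal.comp measurable_updateFinset
  rw [lmargDensity, lmarginal, lmarginal, ← lintegral_const_mul _ hm]
  refine lintegral_congr fun y => ?_
  congr 1
  refine hdep fun i hi => ?_
  have hi' : i ∉ Aᶜ := by simpa using hi
  rw [Function.updateFinset, dif_neg hi']

variable {Ω : Type*} [MeasurableSpace Ω] {P : Measure Ω}

/-- `q` is an everywhere positive joint density of the random vectors `Y 0, …, Y T`, and its
marginal densities are finite everywhere. -/
structure HasJointDensity (P : Measure Ω) (Y : Fin (T + 1) → Ω → EuclideanSpace ℝ (Fin d))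
    (q : (Fin (T + 1) → EuclideanSpace ℝ (Fin d)) → ℝ) : Prop where
  measurable_process : ∀ t, Measurable (Y t)
  measurable_density : Measurable q
  pos : ∀ x, 0 < q x
  map_eq : P.map (fun ω t => Y t ω) = volume.withDensity fun x => ENNReal.ofReal (q x)
  finite : ∀ A : Finset (Fin (T + 1)), A.Nonempty → ∀ x, lmargDensity q A x ≠ ⊤

/-- The measures agree because they agree on boxes. -/
lemma Framework.hasJointDensity {D : ℕ} [IsProbabilityMeasure P]
    {X : Option (EuclideanSpace ℝ (Fin D)) → Fin (T + 1) → Ω → EuclideanSpace ℝ (Fin d)}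
    {p : Option (EuclideanSpace ℝ (Fin D)) → (Fin (T + 1) → EuclideanSpace ℝ (Fin d)) → ℝ}
    {prior : EuclideanSpace ℝ (Fin d) → ℝ} (h : Framework P X p prior)
    (θ : Option (EuclideanSpace ℝ (Fin D))) : HasJointDensity P (X θ) (p θ) where
  measurable_process := h.measurable_process θ
  measurable_density := h.measurable_density θ
  pos := h.density_pos θ
  finite := h.marginal_finite θ
  map_eq := by
    have hm : Measurable fun ω t => X θ t ω := measurable_pi_lambda _ (h.measurable_process θ)
    have key : ∀ B : Fin (T + 1) → Set (EuclideanSpace ℝ (Fin d)), (∀ t, MeasurableSet (B t)) →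
        P.map (fun ω t => X θ t ω) (Set.univ.pi B) =
          volume.withDensity (fun x => ENNReal.ofReal (p θ x)) (Set.univ.pi B) := fun B hB => by
      rw [Measure.map_apply hm (MeasurableSet.univ_pi hB),
        withDensity_apply _ (MeasurableSet.univ_pi hB), ← h.law θ B hB]
      congr 1
      ext ω
      simp
    have := Measure.isProbabilityMeasure_map (μ := P) hm.aemeasurable
    refine ext_of_generate_finite _ generateFrom_pi.symm isPiSystem_pi ?_ ?_
    · rintro _ ⟨B, hB, rfl⟩
      exact key B fun t => hB t (Set.mem_univ t)
    · simpa [Set.pi_univ] using key (fun _ => Set.univ) fun _ => MeasurableSet.univ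

namespace HasJointDensity

variable {Y : Fin (T + 1) → Ω → EuclideanSpace ℝ (Fin d)}
  {q : (Fin (T + 1) → EuclideanSpace ℝ (Fin d)) → ℝ}

lemma measurable_vector (h : HasJointDensity P Y q) : Measurable fun ω t => Y t ω :=
  measurable_pi_lambda _ h.measurable_process

lemma ofReal_margDensity (h : HasJointDensity P Y q) {A : Finset (Fin (T + 1))}
    (hA : A.Nonempty) (x : Fin (T + 1) → EuclideanSpace ℝ (Fin d)) :
    ENNReal.ofReal (margDensity q A x) = lmargDensity q A x :=
  ENNReal.ofReal_toReal (h.finite A hA x)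

lemma margDensity_pos (h : HasJointDensity P Y q) {A : Finset (Fin (T + 1))}
    (hA : A.Nonempty) (x : Fin (T + 1) → EuclideanSpace ℝ (Fin d)) : 0 < margDensity q A x :=
  DDPM.margDensity_pos h.measurable_density h.pos (h.finite A hA x)

lemma lintegral_comp (h : HasJointDensity P Y q)
    {F : (Fin (T + 1) → EuclideanSpace ℝ (Fin d)) → ENNReal} (hF : Measurable F) :
    ∫⁻ ω, F (fun t => Y t ω) ∂P = ∫⁻ x, F x * ENNReal.ofReal (q x) := by
  rw [← lintegral_map hF h.measurable_vector, h.map_eq,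
    lintegral_withDensity_eq_lintegral_mul _ h.measurable_density.ennreal_ofReal hF]
  exact lintegral_congr fun x => mul_comm _ _

lemma lintegral_comp_of_dependsOn (h : HasJointDensity P Y q)
    {F : (Fin (T + 1) → EuclideanSpace ℝ (Fin d)) → ENNReal} (hF : Measurable F)
    {A : Finset (Fin (T + 1))} (hdep : DependsOn F (A : Set (Fin (T + 1))))
    (x₀ : Fin (T + 1) → EuclideanSpace ℝ (Fin d)) :
    ∫⁻ ω, F (fun t => Y t ω) ∂P =
      lmarginal (fun _ => volume) A (fun x => F x * lmargDensity q A x) x₀ := by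
  rw [h.lintegral_comp hF, lintegral_mul_ofReal_of_dependsOn h.measurable_density hF hdep x₀]

/-- The one-dimensional marginal density is the density of a single random vector. -/
lemma lintegral_comp_eval (h : HasJointDensity P Y q) (i : Fin (T + 1))
    {F : EuclideanSpace ℝ (Fin d) → ENNReal} (hF : Measurable F) :
    ∫⁻ ω, F (Y i ω) ∂P =
      ∫⁻ y, F y * ENNReal.ofReal (margDensity q {i} fun _ => y) := by
  rw [h.lintegral_comp_of_dependsOn (F := fun x => F (x i)) (A := {i})
    (hF.comp (measurable_pi_apply i)) (fun x y hxy => by simp only [hxy i (by simp)]) 0,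
    lmarginal_singleton]
  refine lintegral_congr fun y => ?_
  rw [Function.update_self, h.ofReal_margDensity (Finset.singleton_nonempty i)]
  congr 1
  exact lmargDensity_congr _ _ fun j hj => by
    rw [Finset.mem_singleton.1 hj, Function.update_self]

/-- The two-dimensional marginal density is the density of a pair of random vectors. -/
lemma lintegral_comp_pair (h : HasJointDensity P Y q) {i j : Fin (T + 1)} (hij : i ≠ j)
    {F : EuclideanSpace ℝ (Fin d) × EuclideanSpace ℝ (Fin d) → ENNReal} (hF : Measurable F) :
    ∫⁻ ω, F (Y i ω, Y j ω) ∂P =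
      ∫⁻ z, F z * ENNReal.ofReal (margDensity q ({j} ∪ {i})
        (Function.update (fun _ => z.1) j z.2)) ∂(volume.prod volume) := by
  have hmd := measurable_lmargDensity h.measurable_density ({j} ∪ {i})
  have hu : Measurable fun z : EuclideanSpace ℝ (Fin d) × EuclideanSpace ℝ (Fin d) =>
      Function.update (fun _ : Fin (T + 1) => z.1) j z.2 := by
    refine measurable_pi_lambda _ fun k => ?_
    by_cases hk : k = j
    · subst hk; simpa using measurable_snd
    · simpa [hk] using measurable_fst
  have hFm : Measurable fun x : Fin (T + 1) → EuclideanSpace ℝ (Fin d) => F (x i, x j) :=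
    hF.comp ((measurable_pi_apply i).prodMk (measurable_pi_apply j))
  have hFq : Measurable fun x => F (x i, x j) * lmargDensity q ({j} ∪ {i}) x := hFm.mul hmd
  rw [Finset.union_comm, ← Finset.insert_eq] at hFq
  rw [h.lintegral_comp_of_dependsOn (F := fun x => F (x i, x j)) (A := {j} ∪ {i})
    hFm (fun x y hxy => by simp only [hxy i (by simp), hxy j (by simp)]) 0,
    Finset.union_comm, ← Finset.insert_eq, lmarginal_insert _ hFq (by simpa using hij),
    lmarginal_singleton]
  simp_rw [h.ofReal_margDensity (Finset.insert_nonempty i {j})]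
  have hFz : Measurable fun z : EuclideanSpace ℝ (Fin d) × EuclideanSpace ℝ (Fin d) =>
      F z * lmargDensity q {i, j} (Function.update (fun _ => z.1) j z.2) :=
    hF.mul ((measurable_lmargDensity h.measurable_density _).comp hu)
  rw [lintegral_prod _ hFz.aemeasurable]
  refine lintegral_congr fun a => lintegral_congr fun b => ?_
  simp only [Function.update_self, Function.update_of_ne hij]
  congr 1
  refine lmargDensity_congr _ _ fun k hk => ?_
  by_cases hkj : k = j
  · subst hkj; simp
  · rcases Finset.mem_insert.1 hk with rfl | hk
    · simp [hkj]
    · exact absurd (Finset.mem_singleton.1 hk) hkj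

/-- If the conditional density of `Y i` given the times in `B` is Gaussian with a mean depending
on `Y j`, `j ∈ B`, then the joint law of the standardized increment and of the random vectors at the
times in `B` is a product with the standard Gaussian measure: integrate over `Y i` first. -/
lemma measure_standardized_inter (h : HasJointDensity P Y q) {i j : Fin (T + 1)}
    {B : Finset (Fin (T + 1))} (hi : i ∉ B) (hj : j ∈ B)
    {m : EuclideanSpace ℝ (Fin d) → EuclideanSpace ℝ (Fin d)} (hm : Measurable m) {s : ℝ}
    (hs : 0 < s)
    (hcond : ∀ x, condDensity q {i} B x = gaussianDensity (x i) (m (x j)) (s • 1))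
    {S : Set (EuclideanSpace ℝ (Fin d))} (hS : MeasurableSet S)
    {U : Set (B → EuclideanSpace ℝ (Fin d))} (hU : MeasurableSet U) :
    P ((fun ω => (1 / √s) • (Y i ω - m (Y j ω))) ⁻¹' S ∩ (fun ω (k : B) => Y k ω) ⁻¹' U) =
      stdGaussian (EuclideanSpace ℝ (Fin d)) S * P ((fun ω (k : B) => Y k ω) ⁻¹' U) := by
  have hij : j ≠ i := fun hji => hi (hji ▸ hj)
  have hmul : ∀ x, lmargDensity q (insert i B) x =
      ENNReal.ofReal (gaussianDensity (x i) (m (x j)) (s • 1)) * lmargDensity q B x := fun x => by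
    have h0 := h.margDensity_pos ⟨j, hj⟩ x
    rw [← hcond x, ← h.ofReal_margDensity ⟨j, hj⟩, condDensity, Finset.insert_eq,
      ← h.ofReal_margDensity ⟨i, by simp⟩, ← ENNReal.ofReal_mul' h0.le, div_mul_cancel₀ _ h0.ne']
  have hε : Measurable fun x : Fin (T + 1) → EuclideanSpace ℝ (Fin d) =>
      (1 / √s) • (x i - m (x j)) := by fun_prop
  have hr : Measurable fun (x : Fin (T + 1) → EuclideanSpace ℝ (Fin d)) (k : B) => x k := by
    fun_prop
  -- both sides as integrals with respect to the joint density
  set F : EuclideanSpace ℝ (Fin d) → ENNReal := S.indicator 1 with hFdef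
  set G : (Fin (T + 1) → EuclideanSpace ℝ (Fin d)) → ENNReal :=
    fun x => U.indicator 1 (fun k : B => x k) with hGdef
  have hF : Measurable F := measurable_one.indicator hS
  have hG : Measurable G := (measurable_one.indicator hU).comp hr
  have hGdep : DependsOn G (B : Set (Fin (T + 1))) := fun x y hxy => by
    simp only [hGdef]
    congr 1
    funext k
    exact hxy k k.2
  have e1 : P ((fun ω (k : B) => Y k ω) ⁻¹' U) =
      lmarginal (fun _ => volume) B (fun x => G x * lmargDensity q B x) 0 := by
    have hE : MeasurableSet ((fun ω (k : B) => Y k ω) ⁻¹' U) := (hr.comp h.measurable_vector) hU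
    rw [← h.lintegral_comp_of_dependsOn hG hGdep 0, ← lintegral_indicator_one hE]
    rfl
  have e2 : P ((fun ω => (1 / √s) • (Y i ω - m (Y j ω))) ⁻¹' S ∩ (fun ω (k : B) => Y k ω) ⁻¹' U) =
      lmarginal (fun _ => volume) (insert i B)
        (fun x => (F ((1 / √s) • (x i - m (x j))) * G x) * lmargDensity q (insert i B) x) 0 := by
    have hE : MeasurableSet
        ((fun ω => (1 / √s) • (Y i ω - m (Y j ω))) ⁻¹' S ∩ (fun ω (k : B) => Y k ω) ⁻¹' U) :=
      ((hε.comp h.measurable_vector) hS).inter ((hr.comp h.measurable_vector) hU)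
    rw [← h.lintegral_comp_of_dependsOn (F := fun x => F ((1 / √s) • (x i - m (x j))) * G x)
      ((hF.comp hε).mul hG) (fun x y hxy => ?_) 0, ← lintegral_indicator_one hE]
    · refine lintegral_congr fun ω => ?_
      rw [Set.inter_indicator_one, Pi.mul_apply]
      rfl
    · have hyi := hxy i (by simp)
      have hyj := hxy j (by simp [hj])
      have hGG := hGdep (x := x) (y := y) fun k hk => hxy k (by
        simp only [Finset.coe_insert]; exact Set.mem_insert_of_mem _ hk)
      simp only [hyi, hyj, hGG]
  have hFG : Measurable fun x =>
      (F ((1 / √s) • (x i - m (x j))) * G x) * lmargDensity q (insert i B) x :=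
    ((hF.comp hε).mul hG).mul (measurable_lmargDensity h.measurable_density _)
  rw [e1, e2, lmarginal_insert' _ hFG hi]
  have e3 : ∀ x : Fin (T + 1) → EuclideanSpace ℝ (Fin d),
      ∫⁻ y, (F ((1 / √s) • (Function.update x i y i - m (Function.update x i y j))) *
        G (Function.update x i y)) * lmargDensity q (insert i B) (Function.update x i y) =
      stdGaussian (EuclideanSpace ℝ (Fin d)) S * (G x * lmargDensity q B x) := fun x => by
    have hG' : ∀ y, G (Function.update x i y) = G x := fun y => hGdep fun k hk =>
      Function.update_of_ne (ne_of_mem_of_not_mem hk hi) _ _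
    have hq' : ∀ y, lmargDensity q B (Function.update x i y) = lmargDensity q B x := fun y =>
      lmargDensity_congr _ _ fun k hk => Function.update_of_ne (ne_of_mem_of_not_mem hk hi) _ _
    simp_rw [hmul, hG', hq', Function.update_self, Function.update_of_ne hij]
    have e4 := lintegral_standardize_mul_gaussianDensity hF (m (x j)) hs
    rw [lintegral_indicator_one hS] at e4
    have hg : Measurable fun y => gaussianDensity y (m (x j)) (s • 1) :=
      measurable_gaussianDensity measurable_id measurable_const hs
    have hFg : Measurable fun y => F ((1 / √s) • (y - m (x j))) *
        ENNReal.ofReal (gaussianDensity y (m (x j)) (s • 1)) :=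
      (hF.comp (by fun_prop)).mul hg.ennreal_ofReal
    rw [← e4, ← lintegral_mul_const _ hFg]
    exact lintegral_congr fun y => by ring
  simp_rw [e3]
  rw [lmarginal, lintegral_const_mul, lmarginal]
  exact (hG.mul (measurable_lmargDensity h.measurable_density _)).comp measurable_updateFinset

lemma hasLaw_standardized [IsProbabilityMeasure P] (h : HasJointDensity P Y q)
    {i j : Fin (T + 1)}
    {B : Finset (Fin (T + 1))} (hi : i ∉ B) (hj : j ∈ B)
    {m : EuclideanSpace ℝ (Fin d) → EuclideanSpace ℝ (Fin d)} (hm : Measurable m) {s : ℝ}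
    (hs : 0 < s)
    (hcond : ∀ x, condDensity q {i} B x = gaussianDensity (x i) (m (x j)) (s • 1)) :
    HasLaw (fun ω => (1 / √s) • (Y i ω - m (Y j ω)))
      (stdGaussian (EuclideanSpace ℝ (Fin d))) P where
  aemeasurable := by
    have := h.measurable_process i
    have := h.measurable_process j
    fun_prop
  map_eq := by
    have := h.measurable_process i
    have := h.measurable_process j
    ext S hS
    rw [Measure.map_apply (by fun_prop) hS]
    simpa using h.measure_standardized_inter hi hj hm hs hcond hS MeasurableSet.univ

lemma indepFun_standardized [IsProbabilityMeasure P] (h : HasJointDensity P Y q)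
    {i j : Fin (T + 1)}
    {B : Finset (Fin (T + 1))} (hi : i ∉ B) (hj : j ∈ B)
    {m : EuclideanSpace ℝ (Fin d) → EuclideanSpace ℝ (Fin d)} (hm : Measurable m) {s : ℝ}
    (hs : 0 < s)
    (hcond : ∀ x, condDensity q {i} B x = gaussianDensity (x i) (m (x j)) (s • 1)) :
    IndepFun (fun ω => (1 / √s) • (Y i ω - m (Y j ω))) (fun ω (k : B) => Y k ω) P := by
  rw [indepFun_iff_measure_inter_preimage_eq_mul]
  intro S U hS hU
  rw [h.measure_standardized_inter hi hj hm hs hcond hS hU]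
  congr 1
  simpa using (h.measure_standardized_inter hi hj hm hs hcond hS MeasurableSet.univ).symm

end HasJointDensity

end

/-! ### Independence of the noise vectors -/

section

variable {d T : ℕ} {Ω : Type*} [MeasurableSpace Ω] {P : Measure Ω}

/-- Random variables are independent if each of them is independent of the later ones. -/
lemma iIndepFun_of_forall_indepFun_Ioi [IsProbabilityMeasure P] {ι : Type*} [LinearOrder ι]
    [LocallyFiniteOrderTop ι] {E : Type*} [MeasurableSpace E] {Z : ι → Ω → E}
    (h : ∀ k, IndepFun (Z k) (fun ω (j : Finset.Ioi k) => Z j ω) P) : iIndepFun Z P := by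
  rw [iIndepFun_iff_measure_inter_preimage_eq_mul]
  intro S sets hS
  induction S using Finset.induction_on_min with
  | empty => simp
  | insert a s ha ih =>
    have has : a ∉ s := fun hmem => lt_irrefl a (ha a hmem)
    rw [Finset.set_biInter_insert, Finset.prod_insert has,
      ← ih fun i hi => hS i (Finset.mem_insert_of_mem hi)]
    set U : Set (Finset.Ioi a → E) :=
      {z | ∀ j : Finset.Ioi a, j.1 ∈ s → z j ∈ sets j} with hUdef
    have hU : MeasurableSet U := by
      have : U = ⋂ j : Finset.Ioi a, ⋂ _ : j.1 ∈ s, (fun z => z j) ⁻¹' sets j := by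
        ext z; simp [hUdef]
      rw [this]
      exact MeasurableSet.iInter fun j => MeasurableSet.iInter fun hj =>
        measurable_pi_apply j (hS j (Finset.mem_insert_of_mem hj))
    have hpre : ⋂ i ∈ s, Z i ⁻¹' sets i = (fun ω (j : Finset.Ioi a) => Z j ω) ⁻¹' U := by
      ext ω
      simp only [Set.mem_iInter, Set.mem_preimage, hUdef, Set.mem_ofPred_eq]
      exact ⟨fun H j hj => H j hj, fun H i hi => H ⟨i, Finset.mem_Ioi.2 (ha i hi)⟩ hi⟩
    rw [hpre]
    exact (h a).measure_inter_preimage_eq_mul _ _ (hS a (Finset.mem_insert_self a s)) hU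

namespace HasJointDensity

variable {Y : Fin (T + 1) → Ω → EuclideanSpace ℝ (Fin d)}
  {q : (Fin (T + 1) → EuclideanSpace ℝ (Fin d)) → ℝ}

lemma map_eval (h : HasJointDensity P Y q) (i : Fin (T + 1)) :
    P.map (Y i) = volume.withDensity fun y => ENNReal.ofReal (margDensity q {i} fun _ => y) := by
  have hm : Measurable fun y : EuclideanSpace ℝ (Fin d) => margDensity q {i} fun _ => y :=
    (measurable_margDensity h.measurable_density _).comp (by fun_prop)
  refine Measure.ext_of_lintegral _ fun F hF => ?_
  rw [lintegral_map hF (h.measurable_process i), h.lintegral_comp_eval i hF,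
    lintegral_withDensity_eq_lintegral_mul _ hm.ennreal_ofReal hF]
  exact lintegral_congr fun y => mul_comm _ _

/-- The standardized increments of a process which is a Gaussian Markov chain backwards in time,
together with its terminal value, are independent standard Gaussian. -/
theorem exists_iid_backward [IsProbabilityMeasure P] (h : HasJointDensity P Y q)
    {m : Fin T → EuclideanSpace ℝ (Fin d) → EuclideanSpace ℝ (Fin d)}
    (hm : ∀ t, Measurable (m t)) {s : Fin T → ℝ} (hs : ∀ t, 0 < s t)
    (hterm : ∀ x, margDensity q {Fin.last T} x = gaussianDensity (x (Fin.last T)) 0 1)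
    (hcond : ∀ (t : Fin T) x, condDensity q {t.castSucc} (Finset.Ici t.succ) x =
      gaussianDensity (x t.castSucc) (m t (x t.succ)) (s t • 1)) :
    ∃ Z : Fin (T + 1) → Ω → EuclideanSpace ℝ (Fin d),
      (∀ k, Measurable (Z k)) ∧ iIndepFun Z P ∧
      (∀ k, HasLaw (Z k) (stdGaussian (EuclideanSpace ℝ (Fin d))) P) ∧
      (∀ ω, Y (Fin.last T) ω = Z (Fin.last T) ω) ∧
      ∀ (t : Fin T) ω, Y t.castSucc ω = m t (Y t.succ ω) + √(s t) • Z t.castSucc ω := by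
  set z : (Fin (T + 1) → EuclideanSpace ℝ (Fin d)) → Fin (T + 1) → EuclideanSpace ℝ (Fin d) :=
    fun x => Fin.lastCases (x (Fin.last T))
      fun t => (1 / √(s t)) • (x t.castSucc - m t (x t.succ)) with hz
  have hz1 : ∀ x, z x (Fin.last T) = x (Fin.last T) := fun x => by simp [hz]
  have hz2 : ∀ x (t : Fin T),
      z x t.castSucc = (1 / √(s t)) • (x t.castSucc - m t (x t.succ)) := fun x t => by simp [hz]
  have hzm : ∀ k, Measurable fun x => z x k := fun k => by
    induction k using Fin.lastCases with
    | last => simp_rw [hz1]; fun_prop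
    | cast t => simp_rw [hz2]; have := hm t; fun_prop
  -- the coordinates `z x k`, `k ≥ j`, are determined by the coordinates `x k`, `k ≥ j`
  have hzdep : ∀ (j k : Fin (T + 1)) (x y : Fin (T + 1) → EuclideanSpace ℝ (Fin d)), j ≤ k →
      (∀ l, j ≤ l → x l = y l) → z x k = z y k := fun j k x y hjk hxy => by
    induction k using Fin.lastCases with
    | last => rw [hz1, hz1, hxy _ hjk]
    | cast t => rw [hz2, hz2, hxy _ hjk, hxy _ (hjk.trans (Fin.castSucc_lt_succ).le)]
  have hmem1 : ∀ t : Fin T, t.castSucc ∉ Finset.Ici t.succ := fun t => by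
    simp
  have hmem2 : ∀ t : Fin T, t.succ ∈ Finset.Ici t.succ := fun t => by simp
  have hZm : ∀ k, Measurable fun ω => z (fun t => Y t ω) k :=
    fun k => (hzm k).comp h.measurable_vector
  refine ⟨fun k ω => z (fun t => Y t ω) k, hZm, iIndepFun_of_forall_indepFun_Ioi fun k => ?_,
    fun k => ?_, fun ω => (hz1 fun t => Y t ω).symm, fun t ω => ?_⟩
  · induction k using Fin.lastCases with
    | last =>
      have : (fun ω (j : Finset.Ioi (Fin.last T)) => z (fun t => Y t ω) j) = fun _ => 0 := by
        funext ω j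
        exact absurd (Finset.mem_Ioi.1 j.2) (not_lt.2 (Fin.le_last _))
      rw [this]
      exact indepFun_const_right _ _
    | cast t =>
      have hind := h.indepFun_standardized (hmem1 t) (hmem2 t) (hm t) (hs t) (hcond t)
      set ext : (Finset.Ici t.succ → EuclideanSpace ℝ (Fin d)) →
        Fin (T + 1) → EuclideanSpace ℝ (Fin d) :=
        fun b l => if hl : l ∈ Finset.Ici t.succ then b ⟨l, hl⟩ else 0 with hext
      have hextm : Measurable ext := measurable_pi_lambda _ fun l => by
        by_cases hl : l ∈ Finset.Ici t.succ
        · simp only [hext, hl, dite_true]; fun_prop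
        · simp only [hext, hl, dite_false]; fun_prop
      have hcomp := hind.comp measurable_id
        (ψ := fun b (j : Finset.Ioi t.castSucc) => z (ext b) j)
        (measurable_pi_lambda _ fun j => (hzm j).comp hextm)
      refine hcomp.congr (Filter.EventuallyEq.of_eq ?_) (Filter.EventuallyEq.of_eq ?_)
      · funext ω
        exact (hz2 (fun t => Y t ω) t).symm
      · funext ω j
        have hj : t.succ ≤ j.1 := Fin.castSucc_lt_iff_succ_le.1 (Finset.mem_Ioi.1 j.2)
        have hag : ∀ l, t.succ ≤ l → ext (fun k => Y k ω) l = Y l ω := fun l hl => by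
          simp [hext, hl]
        exact hzdep t.succ j (ext fun k => Y k ω) (fun l => Y l ω) hj hag
  · induction k using Fin.lastCases with
    | last =>
      simp_rw [hz1]
      refine ⟨(h.measurable_process _).aemeasurable, ?_⟩
      rw [h.map_eval, stdGaussian_eq_withDensity]
      simp_rw [hterm]
    | cast t =>
      simp_rw [hz2]
      exact h.hasLaw_standardized (hmem1 t) (hmem2 t) (hm t) (hs t) (hcond t)
  · have := (Real.sqrt_pos.2 (hs t)).ne'
    simp only [hz2]
    rw [smul_smul, mul_one_div_cancel this, one_smul]
    abel

end HasJointDensity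

/-- A rotation of two independent standard Gaussian vectors, which are independent of `A`, gives
again two such vectors. -/
lemma hasLaw_prod_rotation {A U W : Ω → EuclideanSpace ℝ (Fin d)}
    {ν : Measure (EuclideanSpace ℝ (Fin d))} [SFinite ν]
    (h : HasLaw (fun ω => ((A ω, U ω), W ω)) ((ν.prod
      (stdGaussian (EuclideanSpace ℝ (Fin d)))).prod (stdGaussian (EuclideanSpace ℝ (Fin d)))) P)
    {a b : ℝ} (ha : 0 ≤ a) (hb : 0 ≤ b) (hab : a ^ 2 + b ^ 2 = 1) :
    HasLaw (fun ω => ((A ω, a • U ω + b • W ω), -b • U ω + a • W ω)) ((ν.prod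
      (stdGaussian (EuclideanSpace ℝ (Fin d)))).prod
        (stdGaussian (EuclideanSpace ℝ (Fin d)))) P := by
  set γ := stdGaussian (EuclideanSpace ℝ (Fin d)) with hγ
  have hcos : Real.cos (Real.arccos a) = a := Real.cos_arccos (by linarith) (by nlinarith)
  have hsin : Real.sin (Real.arccos a) = b := by
    rw [Real.sin_arccos, show 1 - a ^ 2 = b ^ 2 by linarith, Real.sqrt_sq hb]
  have hrot : MeasurePreserving
      (ContinuousLinearMap.rotation (E := EuclideanSpace ℝ (Fin d)) (Real.arccos a))
      (γ.prod γ) (γ.prod γ) :=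
    ⟨by fun_prop, IsGaussian.map_rotation_eq_self (μ := γ) (by simp [hγ]) _⟩
  have hassoc : MeasurePreserving (MeasurableEquiv.prodAssoc :
      (EuclideanSpace ℝ (Fin d) × EuclideanSpace ℝ (Fin d)) × EuclideanSpace ℝ (Fin d) ≃ᵐ _)
      ((ν.prod γ).prod γ) (ν.prod (γ.prod γ)) := measurePreserving_prodAssoc ν γ γ
  have hall := (hassoc.symm.comp ((MeasurePreserving.id ν).prod hrot)).comp hassoc
  refine (hall.comp_hasLaw h).congr (Filter.EventuallyEq.of_eq ?_)
  funext ω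
  change _ = ((A ω, _), _)
  simp only [Prod.map, MeasurableEquiv.prodAssoc, ContinuousLinearMap.rotation_apply, hcos, hsin]
  rfl

/-- The relations between the parameters of the noise schedule. The value of `αbar` at time `0` is
not the empty product, so that the recursion for `αbar` starts at time `1`. -/
structure NoiseSchedule (α αbar β : Fin (T + 1) → ℝ) : Prop where
  alpha_mem : ∀ t : Fin T, α t.succ ∈ Set.Ioo (0 : ℝ) 1
  alphaBar_mem : ∀ t, αbar t ∈ Set.Ioo (0 : ℝ) 1
  beta_pos : ∀ t : Fin T, 0 < β t.succ
  alphaBar_one : ∀ t : Fin T, t.castSucc = 0 → αbar t.succ = α t.succ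
  alphaBar_succ : ∀ t : Fin T, t.castSucc ≠ 0 → αbar t.succ = αbar t.castSucc * α t.succ
  beta_eq : ∀ t : Fin T,
    β t.succ = (1 - αbar t.castSucc) / (1 - αbar t.succ) * (1 - α t.succ)

/-- The value `α = 0` is excluded because the products `αbar` are positive. -/
lemma noiseSchedule_of_prod {α αbar β : Fin (T + 1) → ℝ}
    (hα : ∀ t : Fin T, α t.succ ∈ Set.Ico (0 : ℝ) 1) (hαbar_mem : ∀ t, αbar t ∈ Set.Ioo (0 : ℝ) 1)
    (hβ_mem : ∀ t : Fin T, β t.succ ∈ Set.Ioo (0 : ℝ) 1)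
    (hαbar : ∀ t : Fin T, αbar t.succ = ∏ s ∈ Finset.Iic t, α s.succ)
    (hβ : ∀ t : Fin T,
      β t.succ = (1 - αbar t.castSucc) / (1 - αbar t.succ) * (1 - α t.succ)) :
    NoiseSchedule α αbar β where
  alpha_mem t := by
    refine ⟨lt_of_le_of_ne (hα t).1 fun h0 => (hαbar_mem t.succ).1.ne' ?_, (hα t).2⟩
    rw [hαbar]
    exact Finset.prod_eq_zero (Finset.mem_Iic.2 le_rfl) h0.symm
  alphaBar_mem := hαbar_mem
  beta_pos t := (hβ_mem t).1
  alphaBar_one t ht := by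
    have h0 : (t : ℕ) = 0 := by simpa using congrArg Fin.val ht
    have : Finset.Iic t = {t} := by
      ext s; simp only [Finset.mem_Iic, Finset.mem_singleton, Fin.le_def, Fin.ext_iff]; omega
    rw [hαbar, this, Finset.prod_singleton]
  alphaBar_succ t ht := by
    have h0 : (t : ℕ) ≠ 0 := fun h => ht (Fin.ext (by simpa using h))
    set r : Fin T := ⟨t - 1, by omega⟩ with hr
    have hrt : r.succ = t.castSucc := Fin.ext (by simp [hr]; omega)
    have : Finset.Iic t = insert t (Finset.Iic r) := by
      ext s; simp only [Finset.mem_Iic, Finset.mem_insert, Fin.le_def, Fin.ext_iff, hr]; omega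
    rw [hαbar, this, Finset.prod_insert (by simp [Fin.le_def, hr]; omega), ← hrt, hαbar, mul_comm]
  beta_eq := hβ

namespace HasJointDensity

variable {Y : Fin (T + 1) → Ω → EuclideanSpace ℝ (Fin d)}
  {q : (Fin (T + 1) → EuclideanSpace ℝ (Fin d)) → ℝ}
  {α αbar β : Fin (T + 1) → ℝ} {noise : Fin (T + 1) → Ω → EuclideanSpace ℝ (Fin d)}

lemma measurable_noise (h : HasJointDensity P Y q) (hsch : NoiseSchedule α αbar β)
    (hnoise : ∀ t ω, Y t ω = √(αbar t) • Y 0 ω + √(1 - αbar t) • noise t ω) (t : Fin (T + 1)) :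
    Measurable (noise t) := by
  have hpos : √(1 - αbar t) ≠ 0 :=
    (Real.sqrt_pos.2 (by linarith [(hsch.alphaBar_mem t).2])).ne'
  have : noise t = fun ω => (1 / √(1 - αbar t)) • (Y t ω - √(αbar t) • Y 0 ω) := by
    funext ω
    rw [hnoise t ω, add_sub_cancel_left, smul_smul, one_div_mul_cancel hpos, one_smul]
  rw [this]
  have := h.measurable_process t
  have := h.measurable_process 0
  fun_prop

/-- The value at time `0`, the cumulative noise and the next increment of a Gaussian Markov chain
are independent. -/
lemma hasLaw_noise_increment [IsProbabilityMeasure P] (h : HasJointDensity P Y q)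
    (hsch : NoiseSchedule α αbar β)
    (hcond : ∀ (t : Fin T) x, condDensity q {t.succ} (Finset.Iic t.castSucc) x =
      gaussianDensity (x t.succ) (√(α t.succ) • x t.castSucc) ((1 - α t.succ) • 1))
    (hnoise : ∀ t ω, Y t ω = √(αbar t) • Y 0 ω + √(1 - αbar t) • noise t ω) (t : Fin T)
    (hlaw : HasLaw (fun ω => (Y 0 ω, noise t.castSucc ω))
      ((P.map (Y 0)).prod (stdGaussian (EuclideanSpace ℝ (Fin d)))) P) :
    HasLaw (fun ω => ((Y 0 ω, noise t.castSucc ω),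
        (1 / √(1 - α t.succ)) • (Y t.succ ω - √(α t.succ) • Y t.castSucc ω)))
      (((P.map (Y 0)).prod (stdGaussian (EuclideanSpace ℝ (Fin d)))).prod
        (stdGaussian (EuclideanSpace ℝ (Fin d)))) P := by
  have h1 : t.succ ∉ Finset.Iic t.castSucc := by simp
  have h2 : t.castSucc ∈ Finset.Iic t.castSucc := by simp
  have h0 : (0 : Fin (T + 1)) ∈ Finset.Iic t.castSucc := by simp
  have hs : 0 < 1 - α t.succ := by linarith [(hsch.alpha_mem t).2]
  have hpos : √(1 - αbar t.castSucc) ≠ 0 :=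
    (Real.sqrt_pos.2 (by linarith [(hsch.alphaBar_mem t.castSucc).2])).ne'
  have hm : Measurable fun x : EuclideanSpace ℝ (Fin d) => √(α t.succ) • x := by fun_prop
  have hε := h.hasLaw_standardized h1 h2 hm hs (hcond t)
  have hind := (h.indepFun_standardized h1 h2 hm hs (hcond t)).symm
  refine (indepFun_iff_hasLaw_prodMk_prod hlaw hε).1 ?_
  have hcomp := hind.comp (φ := fun b : Finset.Iic t.castSucc → EuclideanSpace ℝ (Fin d) =>
    (b ⟨0, h0⟩, (1 / √(1 - αbar t.castSucc)) •
      (b ⟨t.castSucc, h2⟩ - √(αbar t.castSucc) • b ⟨0, h0⟩))) (by fun_prop) measurable_id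
  refine hcomp.congr (Filter.EventuallyEq.of_eq ?_) (Filter.EventuallyEq.of_eq rfl)
  funext ω
  simp only [Function.comp]
  congr 1
  rw [hnoise t.castSucc ω, add_sub_cancel_left, smul_smul, one_div_mul_cancel hpos, one_smul]

end HasJointDensity

end

/-! ### Cumulative noise and posterior noise -/

section

variable {d T : ℕ} {Ω : Type*}

lemma norm_sq_rotation {E : Type*} [NormedAddCommGroup E] [InnerProductSpace ℝ E] (u w : E)
    {a b : ℝ} (hab : a ^ 2 + b ^ 2 = 1) :
    ‖a • u + b • w‖ ^ 2 + ‖-b • u + a • w‖ ^ 2 = ‖u‖ ^ 2 + ‖w‖ ^ 2 := by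
  rw [norm_add_sq_real, norm_add_sq_real]
  simp only [norm_smul, mul_pow, Real.norm_eq_abs, sq_abs, real_inner_smul_left,
    real_inner_smul_right]
  linear_combination (‖u‖ ^ 2 + ‖w‖ ^ 2) * hab

/-- The residual of the backward mean in terms of the rotated noise vectors. -/
lemma sub_backward_mean_eq {E : Type*} [AddCommGroup E] [Module ℝ E] {r c s s' : ℝ} (hr : r ≠ 0)
    (hs' : s' ≠ 0) (h : r ^ 2 * s ^ 2 + c ^ 2 = s' ^ 2) (y u e v : E) :
    y - (1 / r) • ((r • y + c • e) - (c ^ 2 / s') • v) =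
      (c ^ 2 / (s' * r)) • (v - ((r * s / s') • u + (c / s') • e)) -
        (s * c / s') • (-(c / s') • u + (r * s / s') • e) := by
  match_scalars
  · field_simp
    ring
  · field_simp
    linear_combination c * h
  · field_simp
  · field_simp
    ring

namespace NoiseSchedule

variable {α αbar β : Fin (T + 1) → ℝ} {Y noise : Fin (T + 1) → Ω → EuclideanSpace ℝ (Fin d)}

/-- The factor of the noise prediction error in the residual of the backward mean. -/
noncomputable def residualFactor (α αbar : Fin (T + 1) → ℝ) (t : Fin T) : ℝ :=
  (1 - α t.succ) / (√(1 - αbar t.succ) * √(α t.succ))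

lemma residualFactor_sq (hsch : NoiseSchedule α αbar β) (t : Fin T) :
    residualFactor α αbar t ^ 2 = (1 - α t.succ) ^ 2 / ((1 - αbar t.succ) * α t.succ) := by
  rw [residualFactor, div_pow, mul_pow, Real.sq_sqrt (by linarith [(hsch.alphaBar_mem t.succ).2]),
    Real.sq_sqrt (hsch.alpha_mem t).1.le]

lemma noise_one (hsch : NoiseSchedule α αbar β)
    (hnoise : ∀ t ω, Y t ω = √(αbar t) • Y 0 ω + √(1 - αbar t) • noise t ω) (t : Fin T)
    (ht : t.castSucc = 0) (ω : Ω) :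
    noise t.succ ω = (1 / √(1 - α t.succ)) • (Y t.succ ω - √(α t.succ) • Y t.castSucc ω) := by
  have hpos : √(1 - α t.succ) ≠ 0 :=
    (Real.sqrt_pos.2 (by linarith [(hsch.alpha_mem t).2])).ne'
  rw [hnoise t.succ ω, ht, hsch.alphaBar_one t ht, add_sub_cancel_left, smul_smul,
    one_div_mul_cancel hpos, one_smul]

lemma noise_succ (hsch : NoiseSchedule α αbar β)
    (hnoise : ∀ t ω, Y t ω = √(αbar t) • Y 0 ω + √(1 - αbar t) • noise t ω) (t : Fin T)
    (ht : t.castSucc ≠ 0) (ω : Ω) :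
    noise t.succ ω =
      (√(α t.succ) * √(1 - αbar t.castSucc) / √(1 - αbar t.succ)) • noise t.castSucc ω +
      (√(1 - α t.succ) / √(1 - αbar t.succ)) •
        ((1 / √(1 - α t.succ)) • (Y t.succ ω - √(α t.succ) • Y t.castSucc ω)) := by
  have hpos : √(1 - α t.succ) ≠ 0 :=
    (Real.sqrt_pos.2 (by linarith [(hsch.alpha_mem t).2])).ne'
  have hpos' : √(1 - αbar t.succ) ≠ 0 :=
    (Real.sqrt_pos.2 (by linarith [(hsch.alphaBar_mem t.succ).2])).ne'
  rw [hnoise t.succ ω, hnoise t.castSucc ω, hsch.alphaBar_succ t ht,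
    Real.sqrt_mul (hsch.alphaBar_mem _).1.le, ← hsch.alphaBar_succ t ht]
  match_scalars
  · field_simp
  · field_simp
    ring
  · field_simp
    ring

/-- The coefficients of the recursion for the cumulative noise. -/
lemma sq_add_sq (hsch : NoiseSchedule α αbar β) (t : Fin T)
    (ht : t.castSucc ≠ 0) :
    √(α t.succ) ^ 2 * √(1 - αbar t.castSucc) ^ 2 + √(1 - α t.succ) ^ 2 =
      √(1 - αbar t.succ) ^ 2 := by
  rw [Real.sq_sqrt (hsch.alpha_mem t).1.le,
    Real.sq_sqrt (by linarith [(hsch.alphaBar_mem t.castSucc).2]),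
    Real.sq_sqrt (by linarith [(hsch.alpha_mem t).2]),
    Real.sq_sqrt (by linarith [(hsch.alphaBar_mem t.succ).2]), hsch.alphaBar_succ t ht]
  ring

end NoiseSchedule

variable [MeasurableSpace Ω] {P : Measure Ω}

namespace HasJointDensity

variable {Y : Fin (T + 1) → Ω → EuclideanSpace ℝ (Fin d)}
  {q : (Fin (T + 1) → EuclideanSpace ℝ (Fin d)) → ℝ}
  {α αbar β : Fin (T + 1) → ℝ} {noise : Fin (T + 1) → Ω → EuclideanSpace ℝ (Fin d)}

/-- The law of the rotated pair consisting of the cumulative noise and the next increment. -/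
lemma hasLaw_noise_rotated [IsProbabilityMeasure P] (h : HasJointDensity P Y q)
    (hsch : NoiseSchedule α αbar β)
    (hcond : ∀ (t : Fin T) x, condDensity q {t.succ} (Finset.Iic t.castSucc) x =
      gaussianDensity (x t.succ) (√(α t.succ) • x t.castSucc) ((1 - α t.succ) • 1))
    (hnoise : ∀ t ω, Y t ω = √(αbar t) • Y 0 ω + √(1 - αbar t) • noise t ω) (t : Fin T)
    (ht : t.castSucc ≠ 0)
    (hlaw : HasLaw (fun ω => (Y 0 ω, noise t.castSucc ω))
      ((P.map (Y 0)).prod (stdGaussian (EuclideanSpace ℝ (Fin d)))) P) :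
    HasLaw (fun ω => ((Y 0 ω, noise t.succ ω),
      -(√(1 - α t.succ) / √(1 - αbar t.succ)) • noise t.castSucc ω +
      (√(α t.succ) * √(1 - αbar t.castSucc) / √(1 - αbar t.succ)) •
        ((1 / √(1 - α t.succ)) • (Y t.succ ω - √(α t.succ) • Y t.castSucc ω))))
      (((P.map (Y 0)).prod (stdGaussian (EuclideanSpace ℝ (Fin d)))).prod
        (stdGaussian (EuclideanSpace ℝ (Fin d)))) P := by
  have hpos' : √(1 - αbar t.succ) ≠ 0 :=
    (Real.sqrt_pos.2 (by linarith [(hsch.alphaBar_mem t.succ).2])).ne'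
  have hfin : IsProbabilityMeasure (P.map (Y 0)) :=
    Measure.isProbabilityMeasure_map (h.measurable_process 0).aemeasurable
  simp_rw [hsch.noise_succ hnoise t ht]
  refine hasLaw_prod_rotation (h.hasLaw_noise_increment hsch hcond hnoise t hlaw)
    (by positivity) (by positivity) ?_
  rw [div_pow, div_pow, mul_pow, ← add_div, hsch.sq_add_sq t ht, div_self (pow_ne_zero 2 hpos')]

/-- The cumulative noise is standard Gaussian and independent of the initial value. -/
theorem hasLaw_noise [IsProbabilityMeasure P] (h : HasJointDensity P Y q)
    (hsch : NoiseSchedule α αbar β)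
    (hcond : ∀ (t : Fin T) x, condDensity q {t.succ} (Finset.Iic t.castSucc) x =
      gaussianDensity (x t.succ) (√(α t.succ) • x t.castSucc) ((1 - α t.succ) • 1))
    (hnoise : ∀ t ω, Y t ω = √(αbar t) • Y 0 ω + √(1 - αbar t) • noise t ω)
    (t : Fin (T + 1)) (ht : t ≠ 0) :
    HasLaw (fun ω => (Y 0 ω, noise t ω))
      ((P.map (Y 0)).prod (stdGaussian (EuclideanSpace ℝ (Fin d)))) P := by
  have hfin : IsProbabilityMeasure (P.map (Y 0)) :=
    Measure.isProbabilityMeasure_map (h.measurable_process 0).aemeasurable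
  induction t using Fin.induction with
  | zero => exact absurd rfl ht
  | succ t ih =>
    by_cases h0 : t.castSucc = 0
    -- the recursion starts at time `1`, where the cumulative noise is the first increment
    · have h1 : t.succ ∉ Finset.Iic t.castSucc := by simp
      have h2 : t.castSucc ∈ Finset.Iic t.castSucc := by simp
      have h0' : (0 : Fin (T + 1)) ∈ Finset.Iic t.castSucc := by simp
      have hs : 0 < 1 - α t.succ := by linarith [(hsch.alpha_mem t).2]
      have hm : Measurable fun x : EuclideanSpace ℝ (Fin d) => √(α t.succ) • x := by fun_prop
      have hε := h.hasLaw_standardized h1 h2 hm hs (hcond t)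
      have hind := (h.indepFun_standardized h1 h2 hm hs (hcond t)).symm
      have hφ : Measurable fun b : Finset.Iic t.castSucc → EuclideanSpace ℝ (Fin d) =>
          b ⟨0, h0'⟩ := by fun_prop
      have hcomp := hind.comp hφ measurable_id
      simp_rw [hsch.noise_one hnoise t h0]
      have hY0 : HasLaw (Y 0) (P.map (Y 0)) P := ⟨(h.measurable_process 0).aemeasurable, rfl⟩
      exact (indepFun_iff_hasLaw_prodMk_prod hY0 hε).1 hcomp
    · have := h.hasLaw_noise_rotated hsch hcond hnoise t h0 (ih h0)
      exact (measurePreserving_fst (μ := (P.map (Y 0)).prod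
        (stdGaussian (EuclideanSpace ℝ (Fin d))))
        (ν := stdGaussian (EuclideanSpace ℝ (Fin d)))).comp_hasLaw this

/-- The noise of the posterior distribution of the previous time step: it is independent of the
initial value and the current cumulative noise (and it vanishes in the first step), the increment
and the previous cumulative noise are obtained from it and from the current cumulative noise by a
rotation, and it describes the residual of the backward mean. -/
theorem exists_posterior_noise [IsProbabilityMeasure P] (h : HasJointDensity P Y q)
    (hsch : NoiseSchedule α αbar β)
    (hcond : ∀ (t : Fin T) x, condDensity q {t.succ} (Finset.Iic t.castSucc) x =
      gaussianDensity (x t.succ) (√(α t.succ) • x t.castSucc) ((1 - α t.succ) • 1))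
    (hnoise : ∀ t ω, Y t ω = √(αbar t) • Y 0 ω + √(1 - αbar t) • noise t ω) (t : Fin T) :
    ∃ N : Ω → EuclideanSpace ℝ (Fin d),
      (N = 0 ∨ HasLaw (fun ω => ((Y 0 ω, noise t.succ ω), N ω))
        (((P.map (Y 0)).prod (stdGaussian (EuclideanSpace ℝ (Fin d)))).prod
          (stdGaussian (EuclideanSpace ℝ (Fin d)))) P) ∧
      (∀ ω, (if t.castSucc = 0 then 0 else ‖noise t.castSucc ω‖ ^ 2) +
        ‖(1 / √(1 - α t.succ)) • (Y t.succ ω - √(α t.succ) • Y t.castSucc ω)‖ ^ 2 =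
        ‖noise t.succ ω‖ ^ 2 + ‖N ω‖ ^ 2) ∧
      ∀ ω v, Y t.castSucc ω - (1 / √(α t.succ)) • (Y t.succ ω -
          ((1 - α t.succ) / √(1 - αbar t.succ)) • v) =
        NoiseSchedule.residualFactor α αbar t • (v - noise t.succ ω) - √(β t.succ) • N ω := by
  have hr : √(α t.succ) ≠ 0 := (Real.sqrt_pos.2 (hsch.alpha_mem t).1).ne'
  have hc : √(1 - α t.succ) ≠ 0 :=
    (Real.sqrt_pos.2 (by linarith [(hsch.alpha_mem t).2])).ne'
  have hs' : √(1 - αbar t.succ) ≠ 0 :=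
    (Real.sqrt_pos.2 (by linarith [(hsch.alphaBar_mem t.succ).2])).ne'
  have hc2 : √(1 - α t.succ) ^ 2 = 1 - α t.succ :=
    Real.sq_sqrt (by linarith [(hsch.alpha_mem t).2])
  have hY : ∀ ω, Y t.succ ω = √(α t.succ) • Y t.castSucc ω + √(1 - α t.succ) •
      ((1 / √(1 - α t.succ)) • (Y t.succ ω - √(α t.succ) • Y t.castSucc ω)) := fun ω => by
    rw [smul_smul, mul_one_div_cancel hc, one_smul]; abel
  by_cases ht : t.castSucc = 0
  -- in the first step the cumulative noise is the increment itself, so that nothing is rotated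
  · refine ⟨0, Or.inl rfl, fun ω => ?_, fun ω v => ?_⟩
    · simp [ht, hsch.noise_one hnoise t ht]
    · have h1 := hsch.alphaBar_one t ht
      have h2 := sub_backward_mean_eq (c := √(1 - α t.succ)) (s := 0) hr hs'
        (by rw [h1]; ring) (Y t.castSucc ω) 0
        ((1 / √(1 - α t.succ)) • (Y t.succ ω - √(α t.succ) • Y t.castSucc ω)) v
      rw [← hY, hc2, ← hsch.noise_one hnoise t ht] at h2
      rw [h2, NoiseSchedule.residualFactor, h1]
      simp [div_self hc]
  · have hβ : √(β t.succ) =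
        √(1 - αbar t.castSucc) * √(1 - α t.succ) / √(1 - αbar t.succ) := by
      rw [hsch.beta_eq, div_mul_eq_mul_div,
        Real.sqrt_div' _ (by linarith [(hsch.alphaBar_mem t.succ).2]),
        Real.sqrt_mul (by linarith [(hsch.alphaBar_mem t.castSucc).2])]
    refine ⟨_, Or.inr (h.hasLaw_noise_rotated hsch hcond hnoise t ht
      (h.hasLaw_noise hsch hcond hnoise _ ht)), fun ω => ?_, fun ω v => ?_⟩
    · rw [if_neg ht, hsch.noise_succ hnoise t ht, norm_sq_rotation]
      rw [div_pow, div_pow, mul_pow, ← add_div, hsch.sq_add_sq t ht, div_self (pow_ne_zero 2 hs')]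
    · have h2 := sub_backward_mean_eq hr hs' (hsch.sq_add_sq t ht) (Y t.castSucc ω)
        (noise t.castSucc ω)
        ((1 / √(1 - α t.succ)) • (Y t.succ ω - √(α t.succ) • Y t.castSucc ω)) v
      rw [← hY, hc2, ← hsch.noise_succ hnoise t ht] at h2
      rw [h2, NoiseSchedule.residualFactor, hβ]

end HasJointDensity

end

/-! ### Extended integrals, divergences and chain rules -/

section

variable {d T : ℕ} {Ω : Type*} [MeasurableSpace Ω] {P : Measure Ω}

lemma coe_ennreal_eq_coe_toReal {x : ENNReal} (hx : x ≠ ⊤) :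
    (x : EReal) = (x.toReal : EReal) := by
  lift x to NNReal using hx
  rfl

lemma extIntegral_coe (μ : Measure Ω) (f : Ω → ℝ) :
    extIntegral μ (fun ω => (f ω : EReal)) =
      ((∫⁻ ω, ENNReal.ofReal (f ω) ∂μ : ENNReal) : EReal) -
        ((∫⁻ ω, ENNReal.ofReal (-f ω) ∂μ : ENNReal) : EReal) := by
  simp only [extIntegral, ← EReal.coe_neg, EReal.real_coe_toENNReal]

lemma extIntegral_congr_ae {μ : Measure Ω} {f g : Ω → EReal} (h : f =ᵐ[μ] g) :
    extIntegral μ f = extIntegral μ g := by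
  have h1 : ∫⁻ x, (f x).toENNReal ∂μ = ∫⁻ x, (g x).toENNReal ∂μ :=
    lintegral_congr_ae (h.mono fun x hx => by simp only [hx])
  have h2 : ∫⁻ x, (-f x).toENNReal ∂μ = ∫⁻ x, (-g x).toENNReal ∂μ :=
    lintegral_congr_ae (h.mono fun x hx => by simp only [hx])
  rw [extIntegral, extIntegral, h1, h2]

lemma extIntegral_mono {μ : Measure Ω} {f g : Ω → EReal} (h : ∀ x, f x ≤ g x) :
    extIntegral μ f ≤ extIntegral μ g :=
  EReal.sub_le_sub
    (EReal.coe_ennreal_le_coe_ennreal_iff.2 (lintegral_mono fun x =>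
      EReal.toENNReal_le_toENNReal (h x)))
    (EReal.coe_ennreal_le_coe_ennreal_iff.2 (lintegral_mono fun x =>
      EReal.toENNReal_le_toENNReal (EReal.neg_le_neg_iff.2 (h x))))

lemma extIntegral_of_integrable {μ : Measure Ω} {f : Ω → ℝ} (hf : Integrable f μ) :
    extIntegral μ (fun ω => (f ω : EReal)) = ((∫ ω, f ω ∂μ : ℝ) : EReal) := by
  have h1 : ∫⁻ ω, ENNReal.ofReal (f ω) ∂μ ≠ ⊤ := hf.lintegral_lt_top.ne
  have h2 : ∫⁻ ω, ENNReal.ofReal (-f ω) ∂μ ≠ ⊤ := hf.neg.lintegral_lt_top.ne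
  rw [extIntegral_coe, integral_eq_lintegral_pos_part_sub_lintegral_neg_part hf, EReal.coe_sub]
  rw [coe_ennreal_eq_coe_toReal h1, coe_ennreal_eq_coe_toReal h2]

lemma lintegral_ofReal_neg_ne_top [IsFiniteMeasure P] {f : Ω → ℝ} {c : ℝ} (hc : ∀ ω, c ≤ f ω) :
    ∫⁻ ω, ENNReal.ofReal (-f ω) ∂P ≠ ⊤ := by
  refine ne_top_of_le_ne_top ?_ (lintegral_mono fun ω =>
    ENNReal.ofReal_le_ofReal (neg_le_neg (hc ω)))
  rw [lintegral_const]
  exact ENNReal.mul_ne_top ENNReal.ofReal_ne_top (measure_ne_top _ _)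

lemma extIntegral_ne_bot [IsFiniteMeasure P] {f : Ω → ℝ} {c : ℝ} (hc : ∀ ω, c ≤ f ω) :
    extIntegral P (fun ω => (f ω : EReal)) ≠ ⊥ := by
  rw [extIntegral_coe, coe_ennreal_eq_coe_toReal (lintegral_ofReal_neg_ne_top hc),
    sub_eq_add_neg, ← EReal.coe_neg]
  refine (EReal.add_ne_bot_iff).2 ⟨?_, EReal.coe_ne_bot _⟩
  exact EReal.coe_ennreal_ne_bot _

lemma extIntegral_nonneg {μ : Measure Ω} {f : Ω → ℝ} (hf : ∀ ω, 0 ≤ f ω) :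
    0 ≤ extIntegral μ (fun ω => (f ω : EReal)) := by
  have : ∀ ω, ENNReal.ofReal (-f ω) = 0 := fun ω =>
    ENNReal.ofReal_of_nonpos (neg_nonpos.2 (hf ω))
  rw [extIntegral_coe]
  simp [this, EReal.coe_ennreal_nonneg]

/-- A function which is bounded below has an integrable negative part, so only the value `⊤` of the
extended integral prevents it from being integrable. -/
lemma integrable_of_extIntegral_ne_top [IsFiniteMeasure P] {f : Ω → ℝ} (hf : Measurable f) {c : ℝ}
    (hc : ∀ ω, c ≤ f ω) (h : extIntegral P (fun ω => (f ω : EReal)) ≠ ⊤) : Integrable f P := by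
  have h2 := lintegral_ofReal_neg_ne_top (P := P) hc
  have h1 : ∫⁻ ω, ENNReal.ofReal (f ω) ∂P ≠ ⊤ := fun h1 => h (by
    rw [extIntegral_coe, h1, coe_ennreal_eq_coe_toReal h2, EReal.coe_ennreal_top,
      EReal.top_sub_coe])
  refine ⟨hf.aestronglyMeasurable, ?_⟩
  rw [hasFiniteIntegral_iff_norm]
  have : ∀ ω, ENNReal.ofReal ‖f ω‖ ≤ ENNReal.ofReal (f ω) + ENNReal.ofReal (-f ω) := fun ω => by
    rcases le_total 0 (f ω) with h0 | h0
    · rw [Real.norm_of_nonneg h0]; exact le_self_add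
    · rw [Real.norm_of_nonpos h0]; exact le_add_self
  refine (lintegral_mono this).trans_lt ?_
  rw [lintegral_add_left hf.ennreal_ofReal]
  exact ENNReal.add_lt_top.2 ⟨h1.lt_top, h2.lt_top⟩

section Gaussian

lemma integrable_norm_sq_stdGaussian :
    Integrable (fun z => ‖z‖ ^ 2) (stdGaussian (EuclideanSpace ℝ (Fin d))) := by
  have h : MemLp id 2 (stdGaussian (EuclideanSpace ℝ (Fin d))) := IsGaussian.memLp_two_id
  exact (memLp_two_iff_integrable_sq_norm h.1).1 h

lemma integrable_inner_stdGaussian (v : EuclideanSpace ℝ (Fin d)) :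
    Integrable (fun z => inner ℝ v z) (stdGaussian (EuclideanSpace ℝ (Fin d))) :=
  (innerSL ℝ v).integrable_comp IsGaussian.integrable_id

lemma integral_inner_stdGaussian (v : EuclideanSpace ℝ (Fin d)) :
    ∫ z, inner ℝ v z ∂stdGaussian (EuclideanSpace ℝ (Fin d)) = 0 :=
  integral_strongDual_stdGaussian (innerSL ℝ v)

/-- The Kullback-Leibler divergence of an isotropic Gaussian from the standard Gaussian. -/
lemma klDensity_gaussianDensity (v : EuclideanSpace ℝ (Fin d)) {s : ℝ} (hs : 0 < s) :
    klDensity (fun y => gaussianDensity y v (s • 1)) (fun y => gaussianDensity y 0 1) =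
      ((-(d : ℝ) / 2 * Real.log s - (∫ z, ‖z‖ ^ 2 ∂stdGaussian (EuclideanSpace ℝ (Fin d))) / 2 +
        (‖v‖ ^ 2 + s * ∫ z, ‖z‖ ^ 2 ∂stdGaussian (EuclideanSpace ℝ (Fin d))) / 2 : ℝ) : EReal) := by
  have hsq : √s ≠ 0 := (Real.sqrt_pos.2 hs).ne'
  -- the logarithmic density ratio in terms of the standardized variable
  set ℓ : EuclideanSpace ℝ (Fin d) → ℝ := fun z =>
    -(d : ℝ) / 2 * Real.log s - ‖z‖ ^ 2 / 2 +
      (‖v‖ ^ 2 + 2 * √s * inner ℝ v z + s * ‖z‖ ^ 2) / 2 with hℓ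
  have hlog : ∀ y, Real.log (gaussianDensity y v (s • 1) / gaussianDensity y 0 1) =
      ℓ ((1 / √s) • (y - v)) := fun y => by
    have h1 : gaussianDensity y 0 1 = gaussianDensity y 0 ((1 : ℝ) • 1) := by rw [one_smul]
    have h2 : ‖y‖ ^ 2 = ‖v‖ ^ 2 + 2 * √s * inner ℝ v ((1 / √s) • (y - v)) +
        s * ‖(1 / √s) • (y - v)‖ ^ 2 := by
      have hy : y = v + √s • ((1 / √s) • (y - v)) := by
        rw [smul_smul, mul_one_div_cancel hsq, one_smul]; abel
      conv_lhs => rw [hy]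
      rw [norm_add_sq_real, inner_smul_right, norm_smul (√s), mul_pow, Real.norm_eq_abs, sq_abs,
        Real.sq_sqrt hs.le]
      ring
    have h3 : ‖y - v‖ ^ 2 / (2 * s) = ‖(1 / √s) • (y - v)‖ ^ 2 / 2 := by
      rw [norm_smul, mul_pow, Real.norm_eq_abs, sq_abs, div_pow, Real.sq_sqrt hs.le]
      field_simp
    rw [h1, Real.log_div (gaussianDensity_pos y v hs).ne' (gaussianDensity_pos y 0 one_pos).ne',
      log_gaussianDensity y v hs, log_gaussianDensity y 0 one_pos, sub_zero, h3,
      Real.log_mul (by positivity) hs.ne', hℓ]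
    simp only [mul_one]
    rw [← h2]
    ring
  have hℓm : Measurable ℓ := by fun_prop
  have hi1 := integrable_norm_sq_stdGaussian (d := d)
  have hi2 := integrable_inner_stdGaussian v
  have hi5 : Integrable (fun z => ‖v‖ ^ 2 + 2 * √s * inner ℝ v z)
      (stdGaussian (EuclideanSpace ℝ (Fin d))) :=
    (integrable_const _).add (hi2.const_mul _)
  have hi3 : Integrable (fun z => ‖v‖ ^ 2 + 2 * √s * inner ℝ v z + s * ‖z‖ ^ 2)
      (stdGaussian (EuclideanSpace ℝ (Fin d))) :=
    hi5.add (hi1.const_mul _)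
  have hi4 : Integrable (fun z => -(d : ℝ) / 2 * Real.log s - ‖z‖ ^ 2 / 2)
      (stdGaussian (EuclideanSpace ℝ (Fin d))) :=
    (integrable_const _).sub (hi1.div_const _)
  have hℓi : Integrable ℓ (stdGaussian (EuclideanSpace ℝ (Fin d))) :=
    hi4.add (hi3.div_const _)
  have hkl : klDensity (fun y => gaussianDensity y v (s • 1)) (fun y => gaussianDensity y 0 1) =
      extIntegral (stdGaussian (EuclideanSpace ℝ (Fin d))) (fun z => (ℓ z : EReal)) := by
    rw [klDensity, extIntegral_coe, extIntegral_coe]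
    congr 2
    · rw [← lintegral_standardize_mul_gaussianDensity hℓm.ennreal_ofReal v hs]
      exact lintegral_congr fun y => by
        rw [hlog, ENNReal.ofReal_mul' (gaussianDensity_pos y v hs).le]
    · have hneg : Measurable fun z => ENNReal.ofReal (-ℓ z) := hℓm.neg.ennreal_ofReal
      rw [← lintegral_standardize_mul_gaussianDensity hneg v hs]
      exact lintegral_congr fun y => by
        rw [hlog, ← neg_mul, ENNReal.ofReal_mul' (gaussianDensity_pos y v hs).le]
  rw [hkl, extIntegral_of_integrable hℓi]
  congr 1
  rw [hℓ, integral_add hi4 (hi3.div_const _), integral_sub (integrable_const _) (hi1.div_const _),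
    integral_div, integral_div, integral_add hi5 (hi1.const_mul _),
    integral_add (integrable_const _) (hi2.const_mul _), integral_const, integral_const,
    integral_const_mul, integral_const_mul, integral_inner_stdGaussian]
  simp

/-- A standard Gaussian vector is orthogonal to every square integrable vector which is
independent of it. -/
lemma integral_inner_eq_zero_of_hasLaw {E : Type*} [MeasurableSpace E] {ν : Measure E}
    [IsProbabilityMeasure ν] {A : Ω → E} {N : Ω → EuclideanSpace ℝ (Fin d)}
    (h : HasLaw (fun ω => (A ω, N ω))
      (ν.prod (stdGaussian (EuclideanSpace ℝ (Fin d)))) P)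
    {φ : E → EuclideanSpace ℝ (Fin d)} (hφ : Measurable φ)
    (hi : Integrable (fun ω => ‖φ (A ω)‖ ^ 2) P) :
    Integrable (fun ω => inner ℝ (φ (A ω)) (N ω)) P ∧
      ∫ ω, inner ℝ (φ (A ω)) (N ω) ∂P = 0 := by
  have hm : Measurable fun z : E × EuclideanSpace ℝ (Fin d) => (inner ℝ (φ z.1) z.2 : ℝ) := by
    fun_prop
  have hi' : Integrable (fun z : E × EuclideanSpace ℝ (Fin d) => ‖φ z.1‖ ^ 2)
      (ν.prod (stdGaussian (EuclideanSpace ℝ (Fin d)))) := by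
    rw [← h.map_eq]
    have hm2 : Measurable fun z : E × EuclideanSpace ℝ (Fin d) => ‖φ z.1‖ ^ 2 := by fun_prop
    exact (integrable_map_measure hm2.aestronglyMeasurable h.aemeasurable).2 hi
  have hN : Integrable (fun z : E × EuclideanSpace ℝ (Fin d) => ‖z.2‖ ^ 2)
      (ν.prod (stdGaussian (EuclideanSpace ℝ (Fin d)))) :=
    integrable_norm_sq_stdGaussian.comp_snd ν
  have hint : Integrable (fun z : E × EuclideanSpace ℝ (Fin d) => (inner ℝ (φ z.1) z.2 : ℝ))
      (ν.prod (stdGaussian (EuclideanSpace ℝ (Fin d)))) := by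
    refine (hi'.add hN).mono' hm.aestronglyMeasurable (ae_of_all _ fun z => ?_)
    refine (norm_inner_le_norm _ _).trans ?_
    simp only [Pi.add_apply]
    nlinarith [sq_nonneg (‖φ z.1‖ - ‖z.2‖), sq_nonneg (‖φ z.1‖), sq_nonneg (‖z.2‖)]
  constructor
  · rw [← h.map_eq] at hint
    exact (integrable_map_measure hm.aestronglyMeasurable h.aemeasurable).1 hint
  · have := h.integral_comp hm.aestronglyMeasurable
    rw [Function.comp_def] at this
    rw [this, integral_prod _ hint]
    simp [integral_inner_stdGaussian]

end Gaussian

@[to_additive]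
lemma last_eq_prod_mul_zero {M : Type*} [CommMonoid M] {n : ℕ} (f : Fin (n + 1) → M)
    (g : Fin n → M) (h : ∀ t : Fin n, f t.succ = g t * f t.castSucc) :
    f (Fin.last n) = (∏ t, g t) * f 0 := by
  induction n with
  | zero => simp
  | succ n ih =>
    rw [← Fin.succ_last, h, Fin.prod_univ_castSucc]
    have := ih (fun t => f t.castSucc) (fun t => g t.castSucc) fun t => by
      rw [← h]; simp
    rw [this, ← mul_assoc, mul_comm (g _)]
    rfl

lemma zero_eq_prod_mul_last {M : Type*} [CommMonoid M] {n : ℕ} (f : Fin (n + 1) → M)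
    (g : Fin n → M) (h : ∀ t : Fin n, f t.castSucc = g t * f t.succ) :
    f 0 = (∏ t, g t) * f (Fin.last n) := by
  induction n with
  | zero => simp
  | succ n ih =>
    have h0 := h 0
    rw [Fin.castSucc_zero] at h0
    rw [h0, Fin.prod_univ_succ, mul_assoc]
    congr 1
    exact ih (fun t => f t.succ) (fun t => g t.succ) fun t => h t.succ

namespace HasJointDensity

variable {Y : Fin (T + 1) → Ω → EuclideanSpace ℝ (Fin d)}
  {q : (Fin (T + 1) → EuclideanSpace ℝ (Fin d)) → ℝ}

lemma margDensity_union_eq (h : HasJointDensity P Y q) {A B : Finset (Fin (T + 1))}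
    (hB : B.Nonempty) (x : Fin (T + 1) → EuclideanSpace ℝ (Fin d)) :
    margDensity q (A ∪ B) x = condDensity q A B x * margDensity q B x := by
  rw [condDensity, div_mul_cancel₀ _ (h.margDensity_pos hB x).ne']

/-- The chain rule for densities, forwards in time. -/
lemma density_eq_prod_forward (h : HasJointDensity P Y q)
    (x : Fin (T + 1) → EuclideanSpace ℝ (Fin d)) :
    q x = (∏ t : Fin T, condDensity q {t.succ} (Finset.Iic t.castSucc) x) *
      margDensity q {0} x := by
  have h1 := last_eq_prod_mul_zero (fun k => margDensity q (Finset.Iic k) x)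
    (fun t : Fin T => condDensity q {t.succ} (Finset.Iic t.castSucc) x) fun t => by
      rw [← h.margDensity_union_eq ⟨t.castSucc, by simp⟩]
      congr 1
      ext k
      simp only [Finset.mem_Iic, Finset.mem_union, Finset.mem_singleton, Fin.le_def, Fin.ext_iff,
        Fin.val_succ, Fin.val_castSucc]
      omega
  have h2 : Finset.Iic (Fin.last T) = Finset.univ := by ext k; simp [Fin.le_last]
  have h3 : Finset.Iic (0 : Fin (T + 1)) = {0} := by ext k; simp
  simp only [h2, h3] at h1
  rw [← h1, margDensity_univ h.pos]

/-- The chain rule for densities, backwards in time. -/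
lemma density_eq_prod_backward (h : HasJointDensity P Y q)
    (x : Fin (T + 1) → EuclideanSpace ℝ (Fin d)) :
    q x = (∏ t : Fin T, condDensity q {t.castSucc} (Finset.Ici t.succ) x) *
      margDensity q {Fin.last T} x := by
  have h1 := zero_eq_prod_mul_last (fun k => margDensity q (Finset.Ici k) x)
    (fun t : Fin T => condDensity q {t.castSucc} (Finset.Ici t.succ) x) fun t => by
      rw [← h.margDensity_union_eq ⟨t.succ, by simp⟩]
      congr 1
      ext k
      simp only [Finset.mem_Ici, Finset.mem_union, Finset.mem_singleton, Fin.le_def, Fin.ext_iff,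
        Fin.val_succ, Fin.val_castSucc]
      omega
  have h2 : Finset.Ici (0 : Fin (T + 1)) = Finset.univ := by ext k; simp
  have h3 : Finset.Ici (Fin.last T) = {Fin.last T} := by
    ext k; simp [Fin.last_le_iff]
  simp only [h2, h3] at h1
  rw [← h1, margDensity_univ h.pos]

lemma lintegral_margDensity [IsProbabilityMeasure P] (h : HasJointDensity P Y q)
    (i : Fin (T + 1)) :
    ∫⁻ y, ENNReal.ofReal (margDensity q {i} fun _ => y) = 1 := by
  have := h.lintegral_comp_eval i (F := fun _ => 1) measurable_const
  simpa using this.symm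

/-- A marginal density is bounded by every bound of a conditional density. -/
lemma margDensity_singleton_le [IsProbabilityMeasure P] (h : HasJointDensity P Y q)
    {i j : Fin (T + 1)} (hij : i ≠ j) {C : ℝ} (hC : 0 ≤ C)
    (hle : ∀ x, condDensity q {i} {j} x ≤ C) (x : Fin (T + 1) → EuclideanSpace ℝ (Fin d)) :
    margDensity q {i} x ≤ C := by
  refine ENNReal.toReal_le_of_le_ofReal hC ?_
  have hcompl : ({i}ᶜ : Finset (Fin (T + 1))) = insert j ({i} ∪ {j})ᶜ := by
    ext k
    simp only [Finset.mem_compl, Finset.mem_singleton, Finset.mem_insert, Finset.mem_union]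
    by_cases hk : k = j
    · simp [hk, hij.symm]
    · simp [hk]
  have h1 : lmargDensity q {i} x =
      ∫⁻ y, lmargDensity q ({i} ∪ {j}) (Function.update x j y) := by
    rw [lmargDensity, hcompl, lmarginal_insert _ h.measurable_density.ennreal_ofReal (by simp)]
    rfl
  rw [h1]
  have h2 : ∀ y, lmargDensity q ({i} ∪ {j}) (Function.update x j y) ≤
      ENNReal.ofReal C * ENNReal.ofReal (margDensity q {j} fun _ => y) := fun y => by
    rw [← h.ofReal_margDensity (by simp), h.margDensity_union_eq (by simp),
      ← ENNReal.ofReal_mul hC, margDensity_congr q {j} (y := fun _ => y)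
        fun k hk => by rw [Finset.mem_singleton.1 hk, Function.update_self]]
    exact ENNReal.ofReal_le_ofReal
      (mul_le_mul_of_nonneg_right (hle _) (h.margDensity_pos (by simp) _).le)
  refine (lintegral_mono h2).trans ?_
  have hm : Measurable fun y : EuclideanSpace ℝ (Fin d) => margDensity q {j} fun _ => y :=
    (measurable_margDensity h.measurable_density _).comp (by fun_prop)
  rw [lintegral_const_mul _ hm.ennreal_ofReal, h.lintegral_margDensity, mul_one]

/-- If `Y j` is a multiple of `Y i` plus an independent Gaussian noise, then almost surely the
conditional density of `Y j` given `Y i` is Gaussian. Both the marginal density and the product of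
the density of `Y i` with the Gaussian density are densities of the pair. -/
lemma ae_condDensity_eq [IsProbabilityMeasure P] (h : HasJointDensity P Y q)
    {i j : Fin (T + 1)} (hij : i ≠ j) {N : Ω → EuclideanSpace ℝ (Fin d)} {c s : ℝ} (hs : 0 < s)
    (hlaw : HasLaw (fun ω => (Y i ω, N ω))
      ((P.map (Y i)).prod (stdGaussian (EuclideanSpace ℝ (Fin d)))) P)
    (hY : ∀ ω, Y j ω = c • Y i ω + √s • N ω) :
    ∀ᵐ ω ∂P, ∀ᵐ y, condDensity q {j} {i} (Function.update (fun _ => Y i ω) j y) =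
      gaussianDensity y (c • Y i ω) (s • 1) := by
  have hfin : IsProbabilityMeasure (P.map (Y i)) :=
    Measure.isProbabilityMeasure_map (h.measurable_process i).aemeasurable
  have hsq : √s ≠ 0 := (Real.sqrt_pos.2 hs).ne'
  have hu : Measurable fun z : EuclideanSpace ℝ (Fin d) × EuclideanSpace ℝ (Fin d) =>
      Function.update (fun _ : Fin (T + 1) => z.1) j z.2 := by
    refine measurable_pi_lambda _ fun k => ?_
    by_cases hk : k = j
    · subst hk; simpa using measurable_snd
    · simpa [hk] using measurable_fst
  set f : EuclideanSpace ℝ (Fin d) × EuclideanSpace ℝ (Fin d) → ENNReal := fun z =>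
    ENNReal.ofReal (margDensity q ({j} ∪ {i}) (Function.update (fun _ => z.1) j z.2)) with hf
  set g : EuclideanSpace ℝ (Fin d) × EuclideanSpace ℝ (Fin d) → ENNReal := fun z =>
    ENNReal.ofReal (gaussianDensity z.2 (c • z.1) (s • 1)) *
      ENNReal.ofReal (margDensity q {i} fun _ => z.1) with hg
  have hfm : Measurable f :=
    ((measurable_margDensity h.measurable_density _).comp hu).ennreal_ofReal
  have hgauss : Measurable fun z : EuclideanSpace ℝ (Fin d) × EuclideanSpace ℝ (Fin d) =>
      gaussianDensity z.2 (c • z.1) (s • 1) :=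
    measurable_gaussianDensity measurable_snd (by fun_prop) hs
  have hmarg : Measurable fun y : EuclideanSpace ℝ (Fin d) => margDensity q {i} fun _ => y :=
    (measurable_margDensity h.measurable_density _).comp (by fun_prop)
  have hgm : Measurable g :=
    hgauss.ennreal_ofReal.mul (hmarg.comp measurable_fst).ennreal_ofReal
  have key : ∀ F : EuclideanSpace ℝ (Fin d) × EuclideanSpace ℝ (Fin d) → ENNReal, Measurable F →
      ∫⁻ z, F z * f z ∂(volume.prod volume) = ∫⁻ z, F z * g z ∂(volume.prod volume) := by
    intro F hF
    have hF' : Measurable fun z : EuclideanSpace ℝ (Fin d) × EuclideanSpace ℝ (Fin d) =>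
        F (z.1, c • z.1 + √s • z.2) := hF.comp (by fun_prop)
    have hFg : Measurable fun z => F z * g z := hF.mul hgm
    rw [← h.lintegral_comp_pair hij hF]
    simp_rw [hY]
    have e1 := hlaw.lintegral_comp hF'.aemeasurable
    refine Eq.trans e1 ?_
    rw [lintegral_prod _ hF'.aemeasurable, h.map_eval,
      lintegral_withDensity_eq_lintegral_mul _ hmarg.ennreal_ofReal
        hF'.lintegral_prod_right', lintegral_prod _ hFg.aemeasurable]
    refine lintegral_congr fun a => ?_
    have hFa : Measurable fun z => F (a, c • a + √s • z) := hF.comp (by fun_prop)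
    rw [Pi.mul_apply, ← lintegral_standardize_mul_gaussianDensity hFa (c • a) hs,
      ← lintegral_const_mul]
    · refine lintegral_congr fun b => ?_
      rw [smul_smul, mul_one_div_cancel hsq, one_smul, add_sub_cancel]
      simp only [hg]
      ring
    · have : Measurable fun y => gaussianDensity y (c • a) (s • 1) :=
        measurable_gaussianDensity measurable_id measurable_const hs
      exact (hFa.comp (by fun_prop)).mul this.ennreal_ofReal
  have hwd : (volume.prod volume).withDensity f = (volume.prod volume).withDensity g := by
    refine Measure.ext_of_lintegral _ fun F hF => ?_
    rw [lintegral_withDensity_eq_lintegral_mul _ hfm hF,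
      lintegral_withDensity_eq_lintegral_mul _ hgm hF]
    simpa only [Pi.mul_apply, mul_comm] using key F hF
  have hae : ∀ᵐ z ∂(volume.prod volume), f z = g z :=
    (withDensity_eq_iff_of_sigmaFinite hfm.aemeasurable hgm.aemeasurable).1 hwd
  have hae2 := Measure.ae_ae_of_ae_prod hae
  have hae3 : ∀ᵐ x ∂(P.map (Y i)), ∀ᵐ y, f (x, y) = g (x, y) := by
    rw [h.map_eval]
    exact (withDensity_absolutelyContinuous _ _).ae_le hae2
  filter_upwards [ae_of_ae_map (h.measurable_process i).aemeasurable hae3] with ω hω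
  filter_upwards [hω] with y hy
  have hmg : margDensity q {i} (Function.update (fun _ => Y i ω) j y) =
      margDensity q {i} fun _ => Y i ω := margDensity_congr q {i} fun k hk => by
    rw [Finset.mem_singleton.1 hk, Function.update_of_ne hij]
  have hpos := h.margDensity_pos (A := {i}) (by simp) fun _ => Y i ω
  simp only [hf, hg] at hy
  rw [← ENNReal.ofReal_mul (gaussianDensity_pos _ _ hs).le, ENNReal.ofReal_eq_ofReal_iff
    (h.margDensity_pos (by simp) _).le (mul_pos (gaussianDensity_pos _ _ hs) hpos).le] at hy
  rw [condDensity, hmg, hy, mul_div_cancel_right₀ _ hpos.ne']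

end HasJointDensity

end

/-! ### The variational bound -/

section

variable {d T : ℕ} {Ω : Type*} [MeasurableSpace Ω] {P : Measure Ω}

namespace HasJointDensity

variable {Y Y' : Fin (T + 1) → Ω → EuclideanSpace ℝ (Fin d)}
  {q q' : (Fin (T + 1) → EuclideanSpace ℝ (Fin d)) → ℝ}

/-- The likelihood ratio of the conditional laws given the value at time `0` has mean one. -/
lemma lintegral_likelihood_ratio [IsProbabilityMeasure P] (h : HasJointDensity P Y q)
    (h' : HasJointDensity P Y' q') :
    ∫⁻ ω, ENNReal.ofReal (q' (fun t => Y t ω) / q (fun t => Y t ω) *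
      (margDensity q {0} (fun _ => Y 0 ω) / margDensity q' {0} (fun _ => Y 0 ω))) ∂P = 1 := by
  have hq0 : Measurable fun y : EuclideanSpace ℝ (Fin d) => margDensity q {0} fun _ => y :=
    (measurable_margDensity h.measurable_density _).comp (by fun_prop)
  have hq0' : Measurable fun y : EuclideanSpace ℝ (Fin d) => margDensity q' {0} fun _ => y :=
    (measurable_margDensity h'.measurable_density _).comp (by fun_prop)
  have hq := h.measurable_density
  have hq' := h'.measurable_density
  set r : EuclideanSpace ℝ (Fin d) → ℝ := fun y =>
    margDensity q {0} (fun _ => y) / margDensity q' {0} (fun _ => y) with hr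
  have hrm : Measurable r := hq0.div hq0'
  have hpos : ∀ y : EuclideanSpace ℝ (Fin d), 0 < margDensity q {0} fun _ => y :=
    fun y => h.margDensity_pos (by simp) _
  have hpos' : ∀ y : EuclideanSpace ℝ (Fin d), 0 < margDensity q' {0} fun _ => y :=
    fun y => h'.margDensity_pos (by simp) _
  have hr0 : ∀ y, 0 < r y := fun y => div_pos (hpos y) (hpos' y)
  have hF : Measurable fun x : Fin (T + 1) → EuclideanSpace ℝ (Fin d) =>
      ENNReal.ofReal (q' x / q x * r (x 0)) := by fun_prop
  have hG : Measurable fun x : Fin (T + 1) → EuclideanSpace ℝ (Fin d) =>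
      ENNReal.ofReal (r (x 0)) := by fun_prop
  calc _ = ∫⁻ x, ENNReal.ofReal (q' x / q x * r (x 0)) * ENNReal.ofReal (q x) :=
        h.lintegral_comp hF
    _ = ∫⁻ x, ENNReal.ofReal (r (x 0)) * ENNReal.ofReal (q' x) := by
        refine lintegral_congr fun x => ?_
        rw [← ENNReal.ofReal_mul' (h.pos x).le, ← ENNReal.ofReal_mul (hr0 _).le]
        congr 1
        have := (h.pos x).ne'
        field_simp
    _ = ∫⁻ ω, ENNReal.ofReal (r (Y' 0 ω)) ∂P := (h'.lintegral_comp hG).symm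
    _ = ∫⁻ y, ENNReal.ofReal (r y) * ENNReal.ofReal (margDensity q' {0} fun _ => y) :=
        h'.lintegral_comp_eval 0 hrm.ennreal_ofReal
    _ = ∫⁻ y, ENNReal.ofReal (margDensity q {0} fun _ => y) := by
        refine lintegral_congr fun y => ?_
        rw [← ENNReal.ofReal_mul (hr0 _).le]
        congr 1
        exact div_mul_cancel₀ _ (hpos' y).ne'
    _ = 1 := h.lintegral_margDensity 0

/-- The variational bound: the expected negative log-likelihood of the value at time `0` is at most
the expectation of the logarithm of the ratio of the conditional density of the later values and
the joint density. It follows from `log L ≤ L - 1` for the likelihood ratio `L`, which has mean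
one. -/
theorem extIntegral_neg_log_le [IsProbabilityMeasure P] (h : HasJointDensity P Y q)
    (h' : HasJointDensity P Y' q')
    (hint : Integrable (fun ω => Real.log (q fun t => Y t ω) -
      Real.log (margDensity q {0} fun _ => Y 0 ω) - Real.log (q' fun t => Y t ω)) P) :
    extIntegral P (fun ω => ((-Real.log (margDensity q' {0} fun _ => Y 0 ω) : ℝ) : EReal)) ≤
      ((∫ ω, (Real.log (q fun t => Y t ω) -
        Real.log (margDensity q {0} fun _ => Y 0 ω) - Real.log (q' fun t => Y t ω)) ∂P : ℝ) :
        EReal) := by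
  set L : Ω → ℝ := fun ω => q' (fun t => Y t ω) / q (fun t => Y t ω) *
      (margDensity q {0} (fun _ => Y 0 ω) / margDensity q' {0} (fun _ => Y 0 ω)) with hL
  have hpos : ∀ ω, 0 < margDensity q {0} fun _ => Y 0 ω := fun ω => h.margDensity_pos (by simp) _
  have hpos' : ∀ ω, 0 < margDensity q' {0} fun _ => Y 0 ω :=
    fun ω => h'.margDensity_pos (by simp) _
  have hL0 : ∀ ω, 0 < L ω := fun ω =>
    mul_pos (div_pos (h'.pos _) (h.pos _)) (div_pos (hpos ω) (hpos' ω))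
  have hLm : Measurable L := by
    have h0 := h.measurable_process 0
    have hq0 : Measurable fun ω => margDensity q {0} fun _ => Y 0 ω :=
      (measurable_margDensity h.measurable_density _).comp (by fun_prop)
    have hq0' : Measurable fun ω => margDensity q' {0} fun _ => Y 0 ω :=
      (measurable_margDensity h'.measurable_density _).comp (by fun_prop)
    exact ((h'.measurable_density.comp h.measurable_vector).div
      (h.measurable_density.comp h.measurable_vector)).mul (hq0.div hq0')
  have hLl : ∫⁻ ω, ENNReal.ofReal (L ω) ∂P = 1 := h.lintegral_likelihood_ratio h'
  have hLi : Integrable L P := by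
    refine ⟨hLm.aestronglyMeasurable, ?_⟩
    rw [hasFiniteIntegral_iff_ofReal (ae_of_all _ fun ω => (hL0 ω).le), hLl]
    exact ENNReal.one_lt_top
  have hL1 : ∫ ω, L ω ∂P = 1 := by
    rw [integral_eq_lintegral_of_nonneg_ae (ae_of_all _ fun ω => (hL0 ω).le)
      hLm.aestronglyMeasurable, hLl, ENNReal.toReal_one]
  have hle : ∀ ω, -Real.log (margDensity q' {0} fun _ => Y 0 ω) ≤
      (L ω - 1) + (Real.log (q fun t => Y t ω) - Real.log (margDensity q {0} fun _ => Y 0 ω) -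
        Real.log (q' fun t => Y t ω)) := fun ω => by
    have h1 := Real.log_le_sub_one_of_pos (hL0 ω)
    have h2 : Real.log (L ω) = Real.log (q' fun t => Y t ω) - Real.log (q fun t => Y t ω) +
        (Real.log (margDensity q {0} fun _ => Y 0 ω) -
          Real.log (margDensity q' {0} fun _ => Y 0 ω)) := by
      rw [hL, Real.log_mul (div_pos (h'.pos _) (h.pos _)).ne' (div_pos (hpos ω) (hpos' ω)).ne',
        Real.log_div (h'.pos _).ne' (h.pos _).ne', Real.log_div (hpos ω).ne' (hpos' ω).ne']
    linarith
  have hL2 : Integrable (fun ω => L ω - 1) P := hLi.sub (integrable_const _)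
  have hL3 : Integrable (fun ω => (L ω - 1) + (Real.log (q fun t => Y t ω) -
      Real.log (margDensity q {0} fun _ => Y 0 ω) - Real.log (q' fun t => Y t ω))) P :=
    hL2.add hint
  refine (extIntegral_mono fun ω => EReal.coe_le_coe_iff.2 (hle ω)).trans ?_
  rw [extIntegral_of_integrable hL3, integral_add hL2 hint,
    integral_sub hLi (integrable_const _), hL1]
  simp

/-- The expected negative log-likelihood as an expectation. -/
lemma expNegLogLik_eq_extIntegral (h : HasJointDensity P Y q)
    {g : EuclideanSpace ℝ (Fin d) → ℝ} (hg : Measurable g) :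
    expNegLogLik (fun x => margDensity q {0} fun _ => x) g =
      extIntegral P (fun ω => ((-Real.log (g (Y 0 ω)) : ℝ) : EReal)) := by
  have h1 : Measurable fun y => ENNReal.ofReal (-Real.log (g y)) := by fun_prop
  have h2 : Measurable fun y => ENNReal.ofReal (-(-Real.log (g y))) := by fun_prop
  rw [expNegLogLik, extIntegral_coe, extIntegral_coe, h.lintegral_comp_eval 0 h1,
    h.lintegral_comp_eval 0 h2]
  congr 2
  · exact lintegral_congr fun y => ENNReal.ofReal_mul' (h.margDensity_pos (by simp) _).le
  · refine lintegral_congr fun y => ?_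
    rw [← neg_mul, ENNReal.ofReal_mul' (h.margDensity_pos (by simp) _).le]

variable {α αbar β : Fin (T + 1) → ℝ} {noise : Fin (T + 1) → Ω → EuclideanSpace ℝ (Fin d)}

/-- The contribution of one time step to the logarithmic density ratio. The Gaussian exponents are
rewritten by means of the posterior noise `N`. -/
lemma log_step_eq (hsch : NoiseSchedule α αbar β) (t : Fin T)
    {x y n N v : EuclideanSpace ℝ (Fin d)} {a : ℝ}
    (h1 : a + ‖(1 / √(1 - α t.succ)) • (y - √(α t.succ) • x)‖ ^ 2 = ‖n‖ ^ 2 + ‖N‖ ^ 2)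
    (h2 : x - (1 / √(α t.succ)) • (y - ((1 - α t.succ) / √(1 - αbar t.succ)) • v) =
      NoiseSchedule.residualFactor α αbar t • (v - n) - √(β t.succ) • N) :
    Real.log (gaussianDensity y (√(α t.succ) • x) ((1 - α t.succ) • 1)) -
      Real.log (gaussianDensity x ((1 / √(α t.succ)) •
        (y - ((1 - α t.succ) / √(1 - αbar t.succ)) • v)) (β t.succ • 1)) =
    (d : ℝ) / 2 * (Real.log (1 - αbar t.castSucc) - Real.log (1 - αbar t.succ)) +
      (a - ‖n‖ ^ 2) / 2 +
      (NoiseSchedule.residualFactor α αbar t ^ 2 / (2 * β t.succ) * ‖n - v‖ ^ 2 +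
        NoiseSchedule.residualFactor α αbar t / √(β t.succ) * inner ℝ (n - v) N) := by
  have hα : 0 < 1 - α t.succ := by linarith [(hsch.alpha_mem t).2]
  have hβ := hsch.beta_pos t
  have hβ' : √(β t.succ) ≠ 0 := (Real.sqrt_pos.2 hβ).ne'
  have ha1 : 0 < 1 - αbar t.castSucc := by linarith [(hsch.alphaBar_mem t.castSucc).2]
  have ha2 : 0 < 1 - αbar t.succ := by linarith [(hsch.alphaBar_mem t.succ).2]
  have hlogβ : Real.log (β t.succ) = Real.log (1 - αbar t.castSucc) - Real.log (1 - αbar t.succ) +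
      Real.log (1 - α t.succ) := by
    rw [hsch.beta_eq, Real.log_mul (by positivity) hα.ne', Real.log_div ha1.ne' ha2.ne']
  rw [log_gaussianDensity _ _ hα, log_gaussianDensity _ _ hβ, h2,
    Real.log_mul (by positivity) hα.ne', Real.log_mul (by positivity) hβ.ne', hlogβ]
  have h3 : ‖y - √(α t.succ) • x‖ ^ 2 / (2 * (1 - α t.succ)) = (‖n‖ ^ 2 + ‖N‖ ^ 2 - a) / 2 := by
    rw [norm_smul, mul_pow, Real.norm_eq_abs, sq_abs, div_pow, Real.sq_sqrt hα.le] at h1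
    rw [← h1]
    field_simp
    ring
  have h4 : ‖NoiseSchedule.residualFactor α αbar t • (v - n) - √(β t.succ) • N‖ ^ 2 =
      NoiseSchedule.residualFactor α αbar t ^ 2 * ‖n - v‖ ^ 2 +
      2 * (NoiseSchedule.residualFactor α αbar t * √(β t.succ)) * inner ℝ (n - v) N +
      β t.succ * ‖N‖ ^ 2 := by
    rw [norm_sub_sq_real, norm_smul, norm_smul, mul_pow, mul_pow, Real.norm_eq_abs,
      Real.norm_eq_abs, sq_abs, sq_abs, Real.sq_sqrt hβ.le, real_inner_smul_left,
      real_inner_smul_right, norm_sub_rev v n, ← neg_sub n v, inner_neg_left]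
    ring
  have h5 : (NoiseSchedule.residualFactor α αbar t ^ 2 * ‖n - v‖ ^ 2 +
      2 * (NoiseSchedule.residualFactor α αbar t * √(β t.succ)) * inner ℝ (n - v) N +
      β t.succ * ‖N‖ ^ 2) / (2 * β t.succ) =
      NoiseSchedule.residualFactor α αbar t ^ 2 / (2 * β t.succ) * ‖n - v‖ ^ 2 +
      NoiseSchedule.residualFactor α αbar t / √(β t.succ) * inner ℝ (n - v) N +
      ‖N‖ ^ 2 / 2 := by
    have hsq : √(β t.succ) * √(β t.succ) = β t.succ := Real.mul_self_sqrt hβ.le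
    have h6 : NoiseSchedule.residualFactor α αbar t / √(β t.succ) =
        NoiseSchedule.residualFactor α αbar t * √(β t.succ) / β t.succ := by
      rw [div_eq_div_iff hβ' hβ.ne', mul_assoc, hsq]
    rw [h6]
    field_simp
  rw [h3, h4, h5]
  ring

/-- The logarithmic density ratio of the variational bound in terms of the noise vectors. -/
theorem log_ratio_eq (hT : Fin.last T ≠ 0) (h : HasJointDensity P Y q)
    (h' : HasJointDensity P Y' q') (hsch : NoiseSchedule α αbar β)
    {v : Fin T → EuclideanSpace ℝ (Fin d) → EuclideanSpace ℝ (Fin d)}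
    (hcond : ∀ (t : Fin T) x, condDensity q {t.succ} (Finset.Iic t.castSucc) x =
      gaussianDensity (x t.succ) (√(α t.succ) • x t.castSucc) ((1 - α t.succ) • 1))
    (hterm' : ∀ x, margDensity q' {Fin.last T} x = gaussianDensity (x (Fin.last T)) 0 1)
    (hcond' : ∀ (t : Fin T) x, condDensity q' {t.castSucc} (Finset.Ici t.succ) x =
      gaussianDensity (x t.castSucc) ((1 / √(α t.succ)) •
        (x t.succ - ((1 - α t.succ) / √(1 - αbar t.succ)) • v t (x t.succ))) (β t.succ • 1))
    {N : Fin T → Ω → EuclideanSpace ℝ (Fin d)} {ω : Ω}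
    (h1 : ∀ t : Fin T, (if t.castSucc = 0 then 0 else ‖noise t.castSucc ω‖ ^ 2) +
      ‖(1 / √(1 - α t.succ)) • (Y t.succ ω - √(α t.succ) • Y t.castSucc ω)‖ ^ 2 =
      ‖noise t.succ ω‖ ^ 2 + ‖N t ω‖ ^ 2)
    (h2 : ∀ (t : Fin T) v, Y t.castSucc ω - (1 / √(α t.succ)) • (Y t.succ ω -
        ((1 - α t.succ) / √(1 - αbar t.succ)) • v) =
      NoiseSchedule.residualFactor α αbar t • (v - noise t.succ ω) - √(β t.succ) • N t ω) :
    Real.log (q fun t => Y t ω) - Real.log (margDensity q {0} fun _ => Y 0 ω) -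
      Real.log (q' fun t => Y t ω) =
    (d : ℝ) / 2 * Real.log (2 * Real.pi * (1 - αbar 0)) +
      (-(d : ℝ) / 2 * Real.log (1 - αbar (Fin.last T)) +
        (‖Y (Fin.last T) ω‖ ^ 2 - ‖noise (Fin.last T) ω‖ ^ 2) / 2) +
      ∑ t : Fin T,
        (NoiseSchedule.residualFactor α αbar t ^ 2 / (2 * β t.succ) *
            ‖noise t.succ ω - v t (Y t.succ ω)‖ ^ 2 +
          NoiseSchedule.residualFactor α αbar t / √(β t.succ) *
            inner ℝ (noise t.succ ω - v t (Y t.succ ω)) (N t ω)) := by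
  have hα : ∀ t : Fin T, 0 < 1 - α t.succ := fun t => by linarith [(hsch.alpha_mem t).2]
  have ha0 : 0 < 1 - αbar 0 := by linarith [(hsch.alphaBar_mem 0).2]
  have h0 : margDensity q {0} (fun t => Y t ω) = margDensity q {0} fun _ => Y 0 ω :=
    margDensity_congr q {0} fun k hk => by rw [Finset.mem_singleton.1 hk]
  have hone : gaussianDensity (Y (Fin.last T) ω) 0 1 =
      gaussianDensity (Y (Fin.last T) ω) 0 ((1 : ℝ) • 1) := by rw [one_smul]
  have hq : Real.log (q fun t => Y t ω) =
      ∑ t : Fin T, Real.log (gaussianDensity (Y t.succ ω) (√(α t.succ) • Y t.castSucc ω)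
        ((1 - α t.succ) • 1)) + Real.log (margDensity q {0} fun _ => Y 0 ω) := by
    rw [h.density_eq_prod_forward, h0, Real.log_mul _ (h.margDensity_pos (by simp) _).ne',
      Real.log_prod]
    · simp_rw [hcond]
    · exact fun t _ => by rw [hcond]; exact (gaussianDensity_pos _ _ (hα t)).ne'
    · exact Finset.prod_ne_zero_iff.2 fun t _ => by
        rw [hcond]; exact (gaussianDensity_pos _ _ (hα t)).ne'
  have hq' : Real.log (q' fun t => Y t ω) =
      ∑ t : Fin T, Real.log (gaussianDensity (Y t.castSucc ω) ((1 / √(α t.succ)) •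
        (Y t.succ ω - ((1 - α t.succ) / √(1 - αbar t.succ)) • v t (Y t.succ ω)))
        (β t.succ • 1)) + (-(d : ℝ) / 2 * Real.log (2 * Real.pi) -
          ‖Y (Fin.last T) ω‖ ^ 2 / 2) := by
    rw [h'.density_eq_prod_backward, Real.log_mul _ (h'.margDensity_pos (by simp) _).ne',
      Real.log_prod, hterm', hone, log_gaussianDensity _ _ one_pos]
    · simp_rw [hcond']
      simp
    · exact fun t _ => by rw [hcond']; exact (gaussianDensity_pos _ _ (hsch.beta_pos t)).ne'
    · exact Finset.prod_ne_zero_iff.2 fun t _ => by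
        rw [hcond']; exact (gaussianDensity_pos _ _ (hsch.beta_pos t)).ne'
  -- the sums over all time steps of the logarithms and of the squared noise norms telescope
  set l : Fin (T + 1) → ℝ := fun k => (d : ℝ) / 2 * Real.log (1 - αbar k) +
    (if k = 0 then 0 else ‖noise k ω‖ ^ 2) / 2 with hl
  have htel := last_eq_sum_add_zero l (fun t => l t.succ - l t.castSucc) fun t => by
    rw [sub_add_cancel]
  have hstep : ∀ t : Fin T,
      Real.log (gaussianDensity (Y t.succ ω) (√(α t.succ) • Y t.castSucc ω)
        ((1 - α t.succ) • 1)) -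
      Real.log (gaussianDensity (Y t.castSucc ω) ((1 / √(α t.succ)) •
        (Y t.succ ω - ((1 - α t.succ) / √(1 - αbar t.succ)) • v t (Y t.succ ω)))
        (β t.succ • 1)) =
      (NoiseSchedule.residualFactor α αbar t ^ 2 / (2 * β t.succ) *
            ‖noise t.succ ω - v t (Y t.succ ω)‖ ^ 2 +
          NoiseSchedule.residualFactor α αbar t / √(β t.succ) *
            inner ℝ (noise t.succ ω - v t (Y t.succ ω)) (N t ω)) -
        (l t.succ - l t.castSucc) := fun t => by
    rw [log_step_eq hsch t (h1 t) (h2 t _), hl]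
    simp only [Fin.succ_ne_zero, if_false]
    ring
  have hsum := Finset.sum_congr (rfl : (Finset.univ : Finset (Fin T)) = Finset.univ)
    fun t _ => hstep t
  rw [Finset.sum_sub_distrib, Finset.sum_sub_distrib (g := fun t : Fin T =>
    l t.succ - l t.castSucc)] at hsum
  have hl1 : l (Fin.last T) = (d : ℝ) / 2 * Real.log (1 - αbar (Fin.last T)) +
    ‖noise (Fin.last T) ω‖ ^ 2 / 2 := by simp [hl, hT]
  have hl0 : l 0 = (d : ℝ) / 2 * Real.log (1 - αbar 0) := by simp [hl]
  rw [hq, hq', Real.log_mul (by positivity) ha0.ne']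
  rw [hl1, hl0] at htel
  linarith

end HasJointDensity

end

/-! ### Evaluation of the variational bound -/

section

variable {d T : ℕ} {Ω : Type*} [MeasurableSpace Ω] {P : Measure Ω}

lemma ereal_coe_sum {ι : Type*} (s : Finset ι) (f : ι → ℝ) :
    ((∑ i ∈ s, f i : ℝ) : EReal) = ∑ i ∈ s, (f i : EReal) :=
  map_sum (⟨⟨Real.toEReal, EReal.coe_zero⟩, EReal.coe_add⟩ : ℝ →+ EReal) f s

namespace HasJointDensity

variable {Y Y' : Fin (T + 1) → Ω → EuclideanSpace ℝ (Fin d)}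
  {q q' : (Fin (T + 1) → EuclideanSpace ℝ (Fin d)) → ℝ}
  {α αbar β : Fin (T + 1) → ℝ} {noise : Fin (T + 1) → Ω → EuclideanSpace ℝ (Fin d)}

/-- The expectation of the terminal part of the logarithmic density ratio. -/
lemma integral_terminal [IsProbabilityMeasure P] {A Z E : Ω → EuclideanSpace ℝ (Fin d)} {c s : ℝ}
    (hs : 0 < s) {ν : Measure (EuclideanSpace ℝ (Fin d))} [IsProbabilityMeasure ν]
    (hlaw : HasLaw (fun ω => (A ω, E ω)) (ν.prod (stdGaussian (EuclideanSpace ℝ (Fin d)))) P)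
    (hZ : ∀ ω, Z ω = c • A ω + √s • E ω) (hA : Integrable (fun ω => ‖c • A ω‖ ^ 2) P) :
    Integrable (fun ω => (‖Z ω‖ ^ 2 - ‖E ω‖ ^ 2) / 2) P ∧
    ∫ ω, (‖Z ω‖ ^ 2 - ‖E ω‖ ^ 2) / 2 ∂P =
      ∫ ω, (-(∫ z, ‖z‖ ^ 2 ∂stdGaussian (EuclideanSpace ℝ (Fin d))) / 2 +
        (‖c • A ω‖ ^ 2 + s * ∫ z, ‖z‖ ^ 2 ∂stdGaussian (EuclideanSpace ℝ (Fin d))) / 2) ∂P := by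
  set m := ∫ z, ‖z‖ ^ 2 ∂stdGaussian (EuclideanSpace ℝ (Fin d)) with hm
  obtain ⟨hi1, hi2⟩ := integral_inner_eq_zero_of_hasLaw hlaw (φ := fun a => c • a) (by fun_prop) hA
  have hE : HasLaw E (stdGaussian (EuclideanSpace ℝ (Fin d))) P :=
    (measurePreserving_snd (μ := ν)
      (ν := stdGaussian (EuclideanSpace ℝ (Fin d)))).comp_hasLaw hlaw
  have hsqm : Measurable fun z : EuclideanSpace ℝ (Fin d) => ‖z‖ ^ 2 := by fun_prop
  have hEi : Integrable (fun ω => ‖E ω‖ ^ 2) P := by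
    have := integrable_norm_sq_stdGaussian (d := d)
    rw [← hE.map_eq] at this
    exact (integrable_map_measure hsqm.aestronglyMeasurable hE.aemeasurable).1 this
  have hEm : ∫ ω, ‖E ω‖ ^ 2 ∂P = m := hE.integral_comp hsqm.aestronglyMeasurable
  have hexp : ∀ ω, (‖Z ω‖ ^ 2 - ‖E ω‖ ^ 2) / 2 =
      ‖c • A ω‖ ^ 2 / 2 + (√s * inner ℝ (c • A ω) (E ω) + (s - 1) / 2 * ‖E ω‖ ^ 2) := fun ω => by
    rw [hZ, norm_add_sq_real, inner_smul_right, norm_smul (√s), mul_pow, Real.norm_eq_abs, sq_abs,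
      Real.sq_sqrt hs.le]
    ring
  have hI2 : Integrable (fun ω => √s * inner ℝ (c • A ω) (E ω) + (s - 1) / 2 * ‖E ω‖ ^ 2) P :=
    (hi1.const_mul _).add (hEi.const_mul _)
  have hI1 : Integrable (fun ω => ‖c • A ω‖ ^ 2 / 2) P := hA.div_const 2
  have hI3 : Integrable (fun ω => (‖c • A ω‖ ^ 2 + s * m) / 2) P :=
    (hA.add (integrable_const _)).div_const 2
  simp_rw [hexp]
  refine ⟨hI1.add hI2, ?_⟩
  rw [integral_add hI1 hI2, integral_add (hi1.const_mul _) (hEi.const_mul _), integral_const_mul,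
    integral_const_mul, hi2, hEm, integral_add (integrable_const _) hI3, integral_div,
    integral_div, integral_div, integral_add hA (integrable_const _)]
  simp
  ring

/-- The upper bound for the expected negative log-likelihood in terms of the prediction errors of
the cumulative noise. -/
theorem extIntegral_neg_log_le_noise [IsProbabilityMeasure P] (hT : Fin.last T ≠ 0)
    (h : HasJointDensity P Y q) (h' : HasJointDensity P Y' q') (hsch : NoiseSchedule α αbar β)
    {v : Fin T → EuclideanSpace ℝ (Fin d) → EuclideanSpace ℝ (Fin d)}
    (hv : ∀ t, Measurable (v t))
    (hcond : ∀ (t : Fin T) x, condDensity q {t.succ} (Finset.Iic t.castSucc) x =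
      gaussianDensity (x t.succ) (√(α t.succ) • x t.castSucc) ((1 - α t.succ) • 1))
    (hnoise : ∀ t ω, Y t ω = √(αbar t) • Y 0 ω + √(1 - αbar t) • noise t ω)
    (hterm' : ∀ x, margDensity q' {Fin.last T} x = gaussianDensity (x (Fin.last T)) 0 1)
    (hcond' : ∀ (t : Fin T) x, condDensity q' {t.castSucc} (Finset.Ici t.succ) x =
      gaussianDensity (x t.castSucc) ((1 / √(α t.succ)) •
        (x t.succ - ((1 - α t.succ) / √(1 - αbar t.succ)) • v t (x t.succ))) (β t.succ • 1)) :
    extIntegral P (fun ω => ((-Real.log (margDensity q' {0} fun _ => Y 0 ω) : ℝ) : EReal)) ≤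
      extIntegral P (fun ω => klDensity
        (fun y => condDensity q {Fin.last T} {0}
          (Function.update (fun _ => Y 0 ω) (Fin.last T) y))
        (fun y => gaussianDensity y 0 1)) +
      (((d : ℝ) / 2 * Real.log (2 * Real.pi * (1 - αbar 0)) : ℝ) : EReal) +
      ∑ t : Fin T, ((1 / (2 * β t.succ) *
          ((1 - α t.succ) ^ 2 / ((1 - αbar t.succ) * α t.succ)) : ℝ) : EReal) *
        extIntegral P (fun ω => ((‖noise t.succ ω - v t (Y t.succ ω)‖ ^ 2 : ℝ) : EReal)) := by
  have hfin : IsProbabilityMeasure (P.map (Y 0)) :=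
    Measure.isProbabilityMeasure_map (h.measurable_process 0).aemeasurable
  have hs : 0 < 1 - αbar (Fin.last T) := by linarith [(hsch.alphaBar_mem (Fin.last T)).2]
  have hlaw := h.hasLaw_noise hsch hcond hnoise (Fin.last T) hT
  have hY0 := h.measurable_process 0
  have hnm := h.measurable_noise hsch hnoise
  have hk : ∀ t : Fin T, 0 < 1 / (2 * β t.succ) *
      ((1 - α t.succ) ^ 2 / ((1 - αbar t.succ) * α t.succ)) := fun t => by
    have h1 := hsch.beta_pos t
    have h2 : 0 < 1 - α t.succ := by linarith [(hsch.alpha_mem t).2]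
    have h3 : 0 < 1 - αbar t.succ := by linarith [(hsch.alphaBar_mem t.succ).2]
    have h4 := (hsch.alpha_mem t).1
    positivity
  -- the divergence of the terminal conditional density is an affine function of the squared norm
  -- of the initial value
  set m := ∫ z, ‖z‖ ^ 2 ∂stdGaussian (EuclideanSpace ℝ (Fin d)) with hm
  set K : Ω → ℝ := fun ω => -(d : ℝ) / 2 * Real.log (1 - αbar (Fin.last T)) - m / 2 +
    (‖√(αbar (Fin.last T)) • Y 0 ω‖ ^ 2 + (1 - αbar (Fin.last T)) * m) / 2 with hK
  have hKm : Measurable K := by fun_prop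
  have hKle : ∀ ω, -(d : ℝ) / 2 * Real.log (1 - αbar (Fin.last T)) - m / 2 +
      (1 - αbar (Fin.last T)) * m / 2 ≤ K ω := fun ω => by
    simp only [hK]
    nlinarith [sq_nonneg ‖√(αbar (Fin.last T)) • Y 0 ω‖]
  have hkl : extIntegral P (fun ω => klDensity
        (fun y => condDensity q {Fin.last T} {0}
          (Function.update (fun _ => Y 0 ω) (Fin.last T) y))
        (fun y => gaussianDensity y 0 1)) = extIntegral P (fun ω => (K ω : EReal)) := by
    refine extIntegral_congr_ae ?_
    filter_upwards [h.ae_condDensity_eq hT.symm hs hlaw (hnoise (Fin.last T))] with ω hω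
    rw [hK, ← klDensity_gaussianDensity (√(αbar (Fin.last T)) • Y 0 ω) hs, klDensity, klDensity]
    exact extIntegral_congr_ae (hω.mono fun y hy => by simp only [hy])
  rw [hkl]
  set D : Fin T → Ω → ℝ := fun t ω => ‖noise t.succ ω - v t (Y t.succ ω)‖ ^ 2 with hD
  have hDm : ∀ t, Measurable (D t) := fun t => by
    have := h.measurable_process t.succ
    have := hnm t.succ
    have := hv t
    fun_prop
  have hD0 : ∀ t ω, 0 ≤ D t ω := fun t ω => sq_nonneg _
  have hterm0 : ∀ t, 0 ≤ ((1 / (2 * β t.succ) *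
      ((1 - α t.succ) ^ 2 / ((1 - αbar t.succ) * α t.succ)) : ℝ) : EReal) *
      extIntegral P (fun ω => (D t ω : EReal)) := fun t =>
    mul_nonneg (EReal.coe_nonneg.2 (hk t).le) (extIntegral_nonneg (hD0 t))
  have hsum0 : 0 ≤ ∑ t : Fin T, ((1 / (2 * β t.succ) *
      ((1 - α t.succ) ^ 2 / ((1 - αbar t.succ) * α t.succ)) : ℝ) : EReal) *
      extIntegral P (fun ω => (D t ω : EReal)) := Finset.sum_nonneg fun t _ => hterm0 t
  -- the bound is trivial unless all the expectations on the right-hand side are finite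
  by_cases hKtop : extIntegral P (fun ω => (K ω : EReal)) = ⊤
  · rw [hKtop, EReal.top_add_coe, EReal.top_add_of_ne_bot
      (ne_bot_of_le_ne_bot EReal.zero_ne_bot hsum0)]
    exact le_top
  by_cases hDtop : ∃ t, extIntegral P (fun ω => (D t ω : EReal)) = ⊤
  · obtain ⟨t, ht⟩ := hDtop
    have h1 := Finset.single_le_sum (fun t _ => hterm0 t) (Finset.mem_univ t)
    rw [ht, EReal.coe_mul_top_of_pos (hk t), top_le_iff] at h1
    rw [h1, EReal.add_top_of_ne_bot]
    · exact le_top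
    · exact EReal.add_ne_bot_iff.2 ⟨extIntegral_ne_bot hKle, EReal.coe_ne_bot _⟩
  push Not at hDtop
  have hKi : Integrable K P := integrable_of_extIntegral_ne_top hKm hKle hKtop
  have hDi : ∀ t, Integrable (D t) P := fun t =>
    integrable_of_extIntegral_ne_top (hDm t) (hD0 t) (hDtop t)
  have hA : Integrable (fun ω => ‖√(αbar (Fin.last T)) • Y 0 ω‖ ^ 2) P := by
    have h1 := (hKi.sub (integrable_const (-(d : ℝ) / 2 * Real.log (1 - αbar (Fin.last T)) -
      m / 2 + (1 - αbar (Fin.last T)) * m / 2))).const_mul 2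
    refine h1.congr (ae_of_all _ fun ω => ?_)
    simp only [hK, Pi.sub_apply]
    ring
  choose N hN1 hN2 hN3 using fun t => h.exists_posterior_noise hsch hcond hnoise t
  have hlog := fun ω => log_ratio_eq hT h h' hsch hcond hterm' hcond'
    (fun t => hN2 t ω) (fun t => hN3 t ω)
  obtain ⟨hti, hte⟩ := integral_terminal hs hlaw (hnoise (Fin.last T)) hA
  -- the mixed terms have mean zero
  have hcross : ∀ t, Integrable (fun ω => (inner ℝ (noise t.succ ω - v t (Y t.succ ω)) (N t ω) : ℝ))
      P ∧ ∫ ω, (inner ℝ (noise t.succ ω - v t (Y t.succ ω)) (N t ω) : ℝ) ∂P = 0 := fun t => by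
    rcases hN1 t with h0 | hl
    · simp [h0]
    · have hvt := hv t
      have hφ : Measurable fun z : EuclideanSpace ℝ (Fin d) × EuclideanSpace ℝ (Fin d) =>
          z.2 - v t (√(αbar t.succ) • z.1 + √(1 - αbar t.succ) • z.2) := by fun_prop
      have hDt := hDi t
      simp only [hD, hnoise t.succ] at hDt
      have := integral_inner_eq_zero_of_hasLaw hl hφ hDt
      simpa only [← hnoise t.succ] using this
  have hI : ∀ t : Fin T, Integrable (fun ω =>
      NoiseSchedule.residualFactor α αbar t ^ 2 / (2 * β t.succ) * D t ω +
        NoiseSchedule.residualFactor α αbar t / √(β t.succ) *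
          inner ℝ (noise t.succ ω - v t (Y t.succ ω)) (N t ω)) P := fun t =>
    ((hDi t).const_mul _).add ((hcross t).1.const_mul _)
  have hIs : Integrable (fun ω => ∑ t : Fin T,
      (NoiseSchedule.residualFactor α αbar t ^ 2 / (2 * β t.succ) * D t ω +
        NoiseSchedule.residualFactor α αbar t / √(β t.succ) *
          inner ℝ (noise t.succ ω - v t (Y t.succ ω)) (N t ω))) P :=
    integrable_finsetSum _ fun t _ => hI t
  have hIt : Integrable (fun ω => -(d : ℝ) / 2 * Real.log (1 - αbar (Fin.last T)) +
      (‖Y (Fin.last T) ω‖ ^ 2 - ‖noise (Fin.last T) ω‖ ^ 2) / 2) P :=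
    (integrable_const _).add hti
  have hIt' : Integrable (fun ω => (d : ℝ) / 2 * Real.log (2 * Real.pi * (1 - αbar 0)) +
      (-(d : ℝ) / 2 * Real.log (1 - αbar (Fin.last T)) +
        (‖Y (Fin.last T) ω‖ ^ 2 - ‖noise (Fin.last T) ω‖ ^ 2) / 2)) P :=
    (integrable_const _).add hIt
  have hW : Integrable (fun ω => Real.log (q fun t => Y t ω) -
      Real.log (margDensity q {0} fun _ => Y 0 ω) - Real.log (q' fun t => Y t ω)) P := by
    simp_rw [hlog]
    exact hIt'.add hIs
  have hKint : ∫ ω, K ω ∂P = ∫ ω, (-(d : ℝ) / 2 * Real.log (1 - αbar (Fin.last T)) +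
      (‖Y (Fin.last T) ω‖ ^ 2 - ‖noise (Fin.last T) ω‖ ^ 2) / 2) ∂P := by
    have h1 : ∀ ω, K ω = -(d : ℝ) / 2 * Real.log (1 - αbar (Fin.last T)) +
        (-m / 2 + (‖√(αbar (Fin.last T)) • Y 0 ω‖ ^ 2 + (1 - αbar (Fin.last T)) * m) / 2) :=
      fun ω => by simp only [hK]; ring
    have h2 : Integrable (fun ω => -m / 2 +
        (‖√(αbar (Fin.last T)) • Y 0 ω‖ ^ 2 + (1 - αbar (Fin.last T)) * m) / 2) P :=
      (integrable_const _).add ((hA.add (integrable_const _)).div_const 2)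
    simp_rw [h1]
    rw [integral_add (integrable_const _) h2, integral_add (integrable_const _) hti, hte]
  refine (h.extIntegral_neg_log_le h' hW).trans (le_of_eq ?_)
  simp_rw [hlog]
  rw [integral_add hIt' hIs, integral_add (integrable_const _) hIt, ← hKint,
    integral_finsetSum _ fun t _ => hI t, extIntegral_of_integrable hKi]
  have hterms : ∀ t : Fin T, ((1 / (2 * β t.succ) *
      ((1 - α t.succ) ^ 2 / ((1 - αbar t.succ) * α t.succ)) : ℝ) : EReal) *
      extIntegral P (fun ω => (D t ω : EReal)) =
      ((∫ ω, (NoiseSchedule.residualFactor α αbar t ^ 2 / (2 * β t.succ) * D t ω +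
        NoiseSchedule.residualFactor α αbar t / √(β t.succ) *
          inner ℝ (noise t.succ ω - v t (Y t.succ ω)) (N t ω)) ∂P : ℝ) : EReal) := fun t => by
    rw [extIntegral_of_integrable (hDi t), ← EReal.coe_mul,
      integral_add ((hDi t).const_mul _) ((hcross t).1.const_mul _), integral_const_mul,
      integral_const_mul, (hcross t).2, hsch.residualFactor_sq]
    congr 1
    ring
  rw [Finset.sum_congr rfl fun t _ => hterms t, ← ereal_coe_sum, ← EReal.coe_add, ← EReal.coe_add]
  congr 1
  simp
  ring

end HasJointDensity

end

end DDPM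

theorem mainTheorem1 {d D T : ℕ} (hd : 1 ≤ d) (hD : 1 ≤ D) (hT : 1 ≤ T)
    {Ω : Type*} [MeasurableSpace Ω] (P : Measure Ω) [IsProbabilityMeasure P]
    (X : Option (EuclideanSpace ℝ (Fin D)) → Fin (T + 1) → Ω → EuclideanSpace ℝ (Fin d))
    (p : Option (EuclideanSpace ℝ (Fin D)) → (Fin (T + 1) → EuclideanSpace ℝ (Fin d)) → ℝ)
    (prior : EuclideanSpace ℝ (Fin d) → ℝ) (α : Fin (T + 1) → ℝ)
    (mean : EuclideanSpace ℝ (Fin D) → Fin (T + 1) →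
      EuclideanSpace ℝ (Fin d) → EuclideanSpace ℝ (Fin d))
    (cov : EuclideanSpace ℝ (Fin D) → Fin (T + 1) →
      EuclideanSpace ℝ (Fin d) → Matrix (Fin d) (Fin d) ℝ)
    (hsetting : DDPM.GaussianFramework P X p prior α mean cov)
    (αbar β : Fin (T + 1) → ℝ)
    (hαbar_mem : ∀ t, αbar t ∈ Set.Ioo (0 : ℝ) 1)
    (hβ_mem : ∀ t : Fin T, β t.succ ∈ Set.Ioo (0 : ℝ) 1)
    (hαbar : ∀ t : Fin T, αbar t.succ = ∏ s ∈ Finset.Iic t, α s.succ)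
    (hβ : ∀ t : Fin T,
      β t.succ = (1 - αbar t.castSucc) / (1 - αbar t.succ) * (1 - α t.succ))
    (noise : Fin (T + 1) → Ω → EuclideanSpace ℝ (Fin d))
    (hnoise : ∀ t ω, X none t ω =
      Real.sqrt (αbar t) • X none 0 ω + Real.sqrt (1 - αbar t) • noise t ω)
    (V : EuclideanSpace ℝ (Fin D) → EuclideanSpace ℝ (Fin d) × ℝ → EuclideanSpace ℝ (Fin d))
    (hV : ∀ θ, Measurable (V θ))
    (hmean : ∀ θ (t : Fin T) x, mean θ t.succ x =
      (1 / Real.sqrt (α t.succ)) • (x - ((1 - α t.succ) / Real.sqrt (1 - αbar t.succ)) •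
        V θ (x, ((t.succ : ℕ) : ℝ))))
    (hcov : ∀ θ (t : Fin T) x, cov θ t.succ x = β t.succ • 1) :
    -- (i) the upper bound for the expected negative log-likelihood, which is well defined
    (∀ θ : EuclideanSpace ℝ (Fin D),
      DDPM.expNegLogLik (fun x₀ => DDPM.margDensity (p none) {0} (fun _ => x₀))
          (fun x₀ => DDPM.margDensity (p (some θ)) {0} (fun _ => x₀)) ≠ ⊥ ∧
      DDPM.expNegLogLik (fun x₀ => DDPM.margDensity (p none) {0} (fun _ => x₀))
          (fun x₀ => DDPM.margDensity (p (some θ)) {0} (fun _ => x₀)) =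
        DDPM.extIntegral P (fun ω =>
          ((-Real.log (DDPM.margDensity (p (some θ)) {0} (fun _ => X none 0 ω)) : ℝ) : EReal)) ∧
      DDPM.extIntegral P (fun ω =>
          ((-Real.log (DDPM.margDensity (p (some θ)) {0} (fun _ => X none 0 ω)) : ℝ) : EReal)) ≤
        DDPM.extIntegral P (fun ω =>
            DDPM.klDensity
              (fun y => DDPM.condDensity (p none) {Fin.last T} {0}
                (Function.update (fun _ => X none 0 ω) (Fin.last T) y))
              prior) +
          (((d : ℝ) / 2 * Real.log (2 * Real.pi * β 1) : ℝ) : EReal) +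
          ∑ t : Fin T,
            ((1 / (2 * β t.succ) *
                ((1 - α t.succ) ^ 2 / ((1 - αbar t.succ) * α t.succ)) : ℝ) : EReal) *
              DDPM.extIntegral P (fun ω =>
                ((‖noise t.succ ω -
                  V θ (Real.sqrt (αbar t.succ) • X none 0 ω +
                    Real.sqrt (1 - αbar t.succ) • noise t.succ ω,
                    ((t.succ : ℕ) : ℝ))‖ ^ 2 : ℝ) : EReal))) ∧
    -- (ii) the cumulative noise at the times `1, …, T`
    (∀ t : Fin T, IndepFun (noise t.succ) (X none 0) P ∧
      ∀ B : Set (EuclideanSpace ℝ (Fin d)), MeasurableSet B →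
        P (noise t.succ ⁻¹' B) = ∫⁻ x in B, ENNReal.ofReal (DDPM.gaussianDensity x 0 1)) ∧
    -- (iii) realization of the backward process; here `Z k` is the noise with number `k + 1`,
    -- for `k = 0, …, T`
    (∀ θ : EuclideanSpace ℝ (Fin D), ∃ Z : Fin (T + 1) → Ω → EuclideanSpace ℝ (Fin d),
      (∀ k, Measurable (Z k)) ∧ iIndepFun Z P ∧ (∀ k, IdentDistrib (Z k) (Z 0) P P) ∧
      (∀ B : Set (EuclideanSpace ℝ (Fin d)), MeasurableSet B →
        P (Z 0 ⁻¹' B) = ∫⁻ z in B, ENNReal.ofReal (DDPM.gaussianDensity z 0 1)) ∧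
      (∀ ω, X (some θ) (Fin.last T) ω = Z (Fin.last T) ω) ∧
      ∀ (t : Fin T) ω, X (some θ) t.castSucc ω =
        (1 / Real.sqrt (α t.succ)) • (X (some θ) t.succ ω -
            ((1 - α t.succ) / Real.sqrt (1 - αbar t.succ)) •
              V θ (X (some θ) t.succ ω, ((t.succ : ℕ) : ℝ))) +
          Real.sqrt (β t.succ) • Z t.castSucc ω) := by
  obtain ⟨n, rfl⟩ : ∃ n, T = n + 1 := ⟨T - 1, by omega⟩
  have hsch := DDPM.noiseSchedule_of_prod hsetting.alpha_mem hαbar_mem hβ_mem hαbar hβ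
  have hjoint := hsetting.hasJointDensity
  have hlast : Fin.last (n + 1) ≠ 0 := Fin.last_pos.ne'
  have hprior : prior = fun x => DDPM.gaussianDensity x 0 1 := funext hsetting.prior_eq
  have hforward : ∀ (t : Fin (n + 1)) x,
      DDPM.condDensity (p none) {t.succ} (Finset.Iic t.castSucc) x =
        DDPM.gaussianDensity (x t.succ) (√(α t.succ) • x t.castSucc) ((1 - α t.succ) • 1) :=
    fun t x => (hsetting.markov_forward t x).trans (hsetting.forward_kernel t x)
  have hkernel : ∀ θ (t : Fin (n + 1)) x,
      DDPM.condDensity (p (some θ)) {t.castSucc} {t.succ} x =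
        DDPM.gaussianDensity (x t.castSucc) ((1 / √(α t.succ)) •
          (x t.succ - ((1 - α t.succ) / √(1 - αbar t.succ)) •
            V θ (x t.succ, ((t.succ : ℕ) : ℝ)))) (β t.succ • 1) := fun θ t x => by
    rw [hsetting.backward_kernel, hmean, hcov]
  have hbackward : ∀ θ (t : Fin (n + 1)) x,
      DDPM.condDensity (p (some θ)) {t.castSucc} (Finset.Ici t.succ) x =
        DDPM.gaussianDensity (x t.castSucc) ((1 / √(α t.succ)) •
          (x t.succ - ((1 - α t.succ) / √(1 - αbar t.succ)) •
            V θ (x t.succ, ((t.succ : ℕ) : ℝ)))) (β t.succ • 1) :=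
    fun θ t x => (hsetting.markov_backward θ t x).trans (hkernel θ t x)
  have hterminal : ∀ θ x, DDPM.margDensity (p (some θ)) {Fin.last (n + 1)} x =
      DDPM.gaussianDensity (x (Fin.last (n + 1))) 0 1 := fun θ x => by
    rw [hsetting.terminal, hsetting.prior_eq]
  have hVm : ∀ θ (t : Fin (n + 1)), Measurable fun x => V θ (x, ((t.succ : ℕ) : ℝ)) :=
    fun θ t => (hV θ).comp (by fun_prop)
  have hβ1 : β 1 = 1 - αbar 0 := by
    have h1 := hβ 0
    have h2 := hsch.alphaBar_one 0 rfl
    have h3 : 1 - α (Fin.succ 0) ≠ 0 := by linarith [(hsch.alpha_mem 0).2]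
    rw [h2, div_mul_cancel₀ _ h3] at h1
    exact h1
  refine ⟨fun θ => ?_, fun t => ?_, fun θ => ?_⟩
  · have hg : Measurable fun x₀ : EuclideanSpace ℝ (Fin d) =>
        DDPM.margDensity (p (some θ)) {0} (fun _ => x₀) :=
      (DDPM.measurable_margDensity (hsetting.measurable_density _) _).comp (by fun_prop)
    have heq := (hjoint none).expNegLogLik_eq_extIntegral hg
    refine ⟨?_, heq, ?_⟩
    · -- the density of the initial value is bounded by the maximum of the Gaussian kernel
      have hβpos : 0 < β (Fin.succ 0) := hsch.beta_pos 0
      have hC : 0 ≤ (2 * Real.pi * β (Fin.succ 0)) ^ (-(d : ℝ) / 2) := by positivity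
      have hle := (hjoint (some θ)).margDensity_singleton_le
        (i := (0 : Fin (n + 1)).castSucc) (j := Fin.succ 0) Fin.castSucc_lt_succ.ne hC fun x => by
          rw [hkernel]; exact DDPM.gaussianDensity_le _ _ hβpos
      rw [heq]
      refine DDPM.extIntegral_ne_bot
        (c := -Real.log ((2 * Real.pi * β (Fin.succ 0)) ^ (-(d : ℝ) / 2))) fun ω => ?_
      exact neg_le_neg (Real.log_le_log ((hjoint (some θ)).margDensity_pos (by simp) _) (hle _))
    · have hbound := (hjoint none).extIntegral_neg_log_le_noise hlast (hjoint (some θ)) hsch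
        (hVm θ) hforward hnoise (hterminal θ) (hbackward θ)
      rw [hβ1, hprior]
      simpa only [← hnoise] using hbound
  · have hlaw := (hjoint none).hasLaw_noise hsch hforward hnoise t.succ (Fin.succ_ne_zero t)
    have h0 : HasLaw (X none 0) (P.map (X none 0)) P :=
      ⟨(hsetting.measurable_process none 0).aemeasurable, rfl⟩
    have hfin : IsProbabilityMeasure (P.map (X none 0)) :=
      Measure.isProbabilityMeasure_map (hsetting.measurable_process none 0).aemeasurable
    have h1 : HasLaw (noise t.succ) (stdGaussian (EuclideanSpace ℝ (Fin d))) P :=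
      (measurePreserving_snd (μ := P.map (X none 0))
        (ν := stdGaussian (EuclideanSpace ℝ (Fin d)))).comp_hasLaw hlaw
    refine ⟨((indepFun_iff_hasLaw_prodMk_prod h0 h1).2 hlaw).symm, fun B hB => ?_⟩
    rw [← Measure.map_apply ((hjoint none).measurable_noise hsch hnoise t.succ) hB, h1.map_eq,
      DDPM.stdGaussian_eq_withDensity, withDensity_apply _ hB]
  · obtain ⟨Z, hZm, hZi, hZl, hZT, hZ⟩ := (hjoint (some θ)).exists_iid_backward
      (m := fun t x => (1 / √(α t.succ)) • (x - ((1 - α t.succ) / √(1 - αbar t.succ)) •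
        V θ (x, ((t.succ : ℕ) : ℝ)))) (s := fun t => β t.succ)
      (fun t => by have := hVm θ t; fun_prop) hsch.beta_pos (hterminal θ) (hbackward θ)
    refine ⟨Z, hZm, hZi, fun k => ⟨(hZm k).aemeasurable, (hZm 0).aemeasurable, ?_⟩,
      fun B hB => ?_, hZT, hZ⟩
    · rw [(hZl k).map_eq, (hZl 0).map_eq]
    · rw [← Measure.map_apply (hZm 0) hB, (hZl 0).map_eq, DDPM.stdGaussian_eq_withDensity,
        withDensity_apply _ hB]
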